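/- **The model.** Fix integers $N_P,N_Y\ge 1$, constants $\delta_P,c,\alpha,\kappa,\gamma>0$ and $\phi\in\mathbb R$. The mid-price takes values in $\mathcal S_X=\{\tfrac k2\delta_P : k=1,\dots,2N_P-1\}$, the inventory in $\mathcal S_Y=\{-N_Y,\dots,N_Y\}$, and the state space is $\mathcal S=\mathcal S_X\times\mathcal S_Y$. In a state $(X,Y)$ the agent quotes $a=(p^a,p^b)$ with prices in $\{0,\delta_P,\dots,N_P\delta_P\}$: a sell order at some $p^a>X$ (no sell order if $Y=-N_Y$) and a buy order at some $p^b<X$ (no buy order if $Y=N_Y$). Write $\lambda(d)=\alpha e^{-\kappa d}$ and $\psi(y)=\phi y^2$. Assume (Assumption 1) that the rates $\lambda_{k,l}(a)$ between neighbouring mid-prices, $|k-l|=1$, satisfy $0<\lambda_{k,l}(a)<C_\lambda$ for a constant $C_\lambda$ and all pairs $a$ of quotes (each possibly absent). *Continuous time, $\mathcal M_0$.* Under the quotes $a_t$, the mid-price $X_t$ jumps from its $k$-th to its $l$-th value, $|k-l|=1$, at rate $\lambda_{k,l}(a_t)$; the counting processes $N^a,N^b$ of executed sell and buy orders have intensities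 $\lambda(|p^a_t-X_t|)$ and $\lambda(|p^b_t-X_t|)$ (zero when the order is absent), there are no simultaneous jumps, and $Y_t=Y_0-N^a_t+N^b_t$. An admissible policy chooses feasible quotes at time $t$ as a (measurable) function of the path of $S=(X,Y)$ before $t$. Its value is $$V_0^\pi(s)=E\Big[\int_0^\infty e^{-\gamma t}\big((p^a_t-X_{t-}-c)\,dN^a_t+(X_{t-}-p^b_t-c)\,dN^b_t+Y_{t-}\,dX_t-\psi(Y_t)\,dt\big)\,\Big|\,S_0=s\Big],$$ terms of absent orders being zero, and $V_0^*=\sup_\pi V_0^\pi$. *Discrete time, $\mathcal M_\Delta$.* Let $\Delta>0$ be so small that all the probabilities below lie in $[0,1]$. Given the state $S_i=(X_i,Y_i)$ and the quotes $a_i$, the following are independent: the next mid-price, which is the $l$-th one with probability $\lambda_{k,l}(a_i)\Delta$ for $|k-l|=1$ ($k$ being the index of $X_i$) and otherwise $X_{i+1}=X_i$; and Bernoulli variables $n^a_i,n^b_i$ with parameters $\lambda(|p^a_i-X_i|)\Delta$ and $\lambda(|p^b_i-X_i|)\Delta$ (zero when the order is absent). Then $Y_{i+1}=Y_i-n_i^a+n_i^b$.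 An admissible policy chooses feasible quotes $a_i$ as a function of $S_0,\dots,S_i$. Its value is $$V_\Delta^\pi(s)=E\Big[\sum_{i\ge0}e^{-i\gamma\Delta}\big((p^a_i-X_i-c)n^a_i+(X_i-p^b_i-c)n^b_i+(X_{i+1}-X_i)Y_i-\psi(Y_i)\Delta\big)\,\Big|\,S_0=s\Big],$$ and $V_\Delta^*=\sup_\pi V_\Delta^\pi$. **Theorem.** The value functions are well defined (the total discounted rewards converge almost surely and are integrable, and the suprema are finite), and there are stationary Markov deterministic policies $\pi_0^*$ and, for every such $\Delta$, $\pi_\Delta^*$ (maps from states to feasible quotes) with $V_0^*(s)=V_0^{\pi_0^*}(s)$ and $V_\Delta^*(s)=V_\Delta^{\pi_\Delta^*}(s)$ for all $s\in\mathcal S$. Moreover, if $\pi_0^*$ is the only stationary Markov deterministic policy that is optimal in $\mathcal M_0$, then there are $\Delta_0>0$ and $C_V>0$, not depending on $\Delta$, such that for every $\Delta\in(0,\Delta_0)$ the process $\mathcal M_\Delta$ is defined and (i) $\pi_\Delta^*=\pi_0^*$ for every optimal stationary Markov deterministic policy $\pi_\Delta^*$ of $\mathcal M_\Delta$ (so the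 optimal policy of $\mathcal M_\Delta$ is unique as well); (ii) $\max_{s\in\mathcal S}|V_\Delta^*(s)-V_0^*(s)|\le C_V\Delta$. -/

import Mathlib

open MeasureTheory
open scoped unitInterval

noncomputable section

/-- A pair of quotes (ask price, bid price) on the grid `{0, δ, …, NP δ}`, a price being given by its
index. `none` means that no order is put on that side of the book. -/
@[ext]
structure Quotes (NP : ℕ) where
  ask : Option (Fin (NP + 1))
  bid : Option (Fin (NP + 1))

instance (NP : ℕ) : MeasurableSpace (Quotes NP) := ⊤

/-- The parameters of the market-making model: `rate k l a` is the transition rate of the mid-price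
from its `k`-th to its `l`-th value under the quotes `a` (used only for neighbouring `k`, `l`; the
indices start at `0`), `tick` is the tick size, `c` the transaction cost, `phi` the inventory penalty,
`gamma` the discount factor, and `d ↦ alpha * exp (-kappa * d)` the intensity of order fills. -/
structure MMModel where
  NP : ℕ
  NY : ℕ
  tick : ℝ
  c : ℝ
  alpha : ℝ
  kappa : ℝ
  phi : ℝ
  gamma : ℝ
  rate : Fin (2 * NP - 1) → Fin (2 * NP - 1) → Quotes NP → ℝ
  NP_pos : 0 < NP
  NY_pos : 0 < NY
  tick_pos : 0 < tick
  c_pos : 0 < c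
  alpha_pos : 0 < alpha
  kappa_pos : 0 < kappa
  gamma_pos : 0 < gamma

namespace MMModel

variable (M : MMModel)

/-- The rates between neighbouring mid-prices are positive and uniformly bounded. -/
def RateAssumption : Prop :=
  ∃ C : ℝ, 0 < C ∧ ∀ (k l : Fin (2 * M.NP - 1)) (a : Quotes M.NP),
    ((k : ℕ) + 1 = l ∨ (l : ℕ) + 1 = k) → 0 < M.rate k l a ∧ M.rate k l a < C

/-! ### States and actions -/

/-- Indices of the mid-prices. -/
abbrev PriceIdx : Type := Fin (2 * M.NP - 1)

/-- Inventories `-NY, …, NY`. -/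
abbrev Inventory : Type := Set.Icc (-(M.NY : ℤ)) (M.NY : ℤ)

/-- A state is a pair (mid-price, inventory). -/
abbrev State : Type := M.PriceIdx × M.Inventory

/-- The mid-price with index `k`, that is `(k + 1) δ / 2`. -/
def mid (k : M.PriceIdx) : ℝ := ((k : ℕ) + 1 : ℝ) / 2 * M.tick

/-- The grid price `p δ`. -/
def quote (p : Fin (M.NP + 1)) : ℝ := ((p : ℕ) : ℝ) * M.tick

/-- The inventory as a real number. -/
def inv (s : M.State) : ℝ := ((s.2 : ℤ) : ℝ)

/-- The quoting rule: a sell order is put, at a price above the mid-price, unless the inventory is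
`-NY`; a buy order is put, at a price below the mid-price, unless the inventory is `NY`. -/
def Feasible (s : M.State) (a : Quotes M.NP) : Prop :=
  (if (s.2 : ℤ) = -(M.NY : ℤ) then a.ask = none
    else ∃ p, a.ask = some p ∧ M.mid s.1 < M.quote p) ∧
  (if (s.2 : ℤ) = (M.NY : ℤ) then a.bid = none
    else ∃ p, a.bid = some p ∧ M.quote p < M.mid s.1)

/-! ### Rates and rewards -/

/-- The rate of an upward move of the mid-price (`0` at the top of the grid). -/
def upRate (k : M.PriceIdx) (a : Quotes M.NP) : ℝ :=
  if h : (k : ℕ) + 1 < 2 * M.NP - 1 then M.rate k ⟨k + 1, h⟩ a else 0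

/-- The rate of a downward move of the mid-price (`0` at the bottom of the grid). -/
def downRate (k : M.PriceIdx) (a : Quotes M.NP) : ℝ :=
  if 0 < (k : ℕ) then M.rate k ⟨k - 1, lt_of_le_of_lt (Nat.sub_le _ _) k.2⟩ a else 0

/-- The fill intensity of an order quoted at the price `q` when the mid-price is the `k`-th one. -/
def fillRate (k : M.PriceIdx) : Option (Fin (M.NP + 1)) → ℝ
  | none => 0
  | some p => M.alpha * Real.exp (-M.kappa * |M.quote p - M.mid k|)

/-- The next higher mid-price (unchanged at the top). -/
def moveUp (k : M.PriceIdx) : M.PriceIdx :=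
  if h : (k : ℕ) + 1 < 2 * M.NP - 1 then ⟨k + 1, h⟩ else k

/-- The next lower mid-price (unchanged at the bottom). -/
def moveDown (k : M.PriceIdx) : M.PriceIdx := ⟨k - 1, lt_of_le_of_lt (Nat.sub_le _ _) k.2⟩

/-- The inventory `y + d`. The projection to `[-NY, NY]` never acts under feasible quotes. -/
def addInv (y : M.Inventory) (d : ℤ) : M.Inventory :=
  Set.projIcc (-(M.NY : ℤ)) (M.NY : ℤ) (by lia) ((y : ℤ) + d)

/-- Profit `pᵃ - X - c` of an executed sell order. -/
def sellProfit (s : M.State) : Option (Fin (M.NP + 1)) → ℝ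
  | none => 0
  | some p => M.quote p - M.mid s.1 - M.c

/-- Profit `X - pᵇ - c` of an executed buy order. -/
def buyProfit (s : M.State) : Option (Fin (M.NP + 1)) → ℝ
  | none => 0
  | some p => M.mid s.1 - M.quote p - M.c

/-- Inventory penalty `ψ(y) = φ y²`. -/
def penalty (s : M.State) : ℝ := M.phi * M.inv s ^ 2

/-- A stationary Markov deterministic policy. -/
@[ext]
structure StatPolicy where
  act : M.State → Quotes M.NP
  feasible : ∀ s, M.Feasible s (act s)

end MMModel

/-! ### The continuous-time problem -/

/-- The possible jumps of the state: the mid-price moves up or down, the sell order is executed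
(a jump of `Nᵃ`), the buy order is executed (a jump of `Nᵇ`). -/
inductive MMEvent
  | up
  | down
  | sell
  | buy

namespace MMModel

variable (M : MMModel)

/-- The rate of each kind of jump in the state `s` under the quotes `a`. -/
def eventRate (s : M.State) (a : Quotes M.NP) : MMEvent → ℝ
  | .up => M.upRate s.1 a
  | .down => M.downRate s.1 a
  | .sell => M.fillRate s.1 a.ask
  | .buy => M.fillRate s.1 a.bid

/-- The total jump rate. -/
def totalRate (s : M.State) (a : Quotes M.NP) : ℝ :=
  M.eventRate s a .up + M.eventRate s a .down + M.eventRate s a .sell + M.eventRate s a .buy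

/-- The state after a jump. -/
def afterEvent (s : M.State) : MMEvent → M.State
  | .up => (M.moveUp s.1, s.2)
  | .down => (M.moveDown s.1, s.2)
  | .sell => (s.1, M.addInv s.2 (-1))
  | .buy => (s.1, M.addInv s.2 1)

/-- The increment of the running reward at a jump: `(pᵃ - X - c) dNᵃ + (X - pᵇ - c) dNᵇ + Y dX`. -/
def eventReward (s : M.State) (a : Quotes M.NP) : MMEvent → ℝ
  | .up => M.inv s * (M.mid (M.moveUp s.1) - M.mid s.1)
  | .down => M.inv s * (M.mid (M.moveDown s.1) - M.mid s.1)
  | .sell => M.sellProfit s a.ask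
  | .buy => M.buyProfit s a.bid

/-- For `v` uniform in `[0, 1]`, an event drawn with probabilities `eventRate / totalRate`. -/
def drawEvent (s : M.State) (a : Quotes M.NP) (v : ℝ) : MMEvent :=
  if v * M.totalRate s a < M.eventRate s a .up then .up
  else if v * M.totalRate s a < M.eventRate s a .up + M.eventRate s a .down then .down
  else if v * M.totalRate s a <
      M.eventRate s a .up + M.eventRate s a .down + M.eventRate s a .sell then .sell
  else .buy

/-- An admissible policy in continuous time. The history after `n` jumps consists of the jump times
`0 = T₀, T₁, …, Tₙ` and of the states that were entered at these times; `act n h r` is the pair of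
quotes in force at the time `Tₙ + r`, `r ≤ Tₙ₊₁ - Tₙ`, so that the quotes at a time `t` depend on the
path of the state before `t` (and on nothing else: past quotes are functions of the past path). -/
structure ContPolicy where
  act : (n : ℕ) → (Fin (n + 1) → ℝ × M.State) → ℝ → Quotes M.NP
  measurable_act : ∀ n, Measurable fun q : (Fin (n + 1) → ℝ × M.State) × ℝ => act n q.1 q.2
  feasible : ∀ n h r, M.Feasible (h (Fin.last n)).2 (act n h r)

/-- A stationary Markov policy as an admissible policy in continuous time. -/
def StatPolicy.toCont {M : MMModel} (π : M.StatPolicy) : M.ContPolicy where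
  act n h _ := π.act (h (Fin.last n)).2
  measurable_act n := by
    have h1 : Measurable π.act := measurable_of_countable _
    exact h1.comp ((measurable_pi_apply (Fin.last n)).comp measurable_fst).snd
  feasible n h _ := π.feasible _

/-- Independent pairs of independent uniform variables, one pair for each jump. -/
def contMeasure : Measure (ℕ → I × I) :=
  Measure.infinitePi fun _ => (volume : Measure I).prod (volume : Measure I)

/-- The time between the `n`-th and the next jump, given the history `h`. For `u` uniform it exceeds
`t` with probability `exp (- ∫₀ᵗ totalRate)`. -/
def holdTime (π : M.ContPolicy) (n : ℕ) (h : Fin (n + 1) → ℝ × M.State) (u : I) : ℝ :=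
  sInf {t : ℝ | 0 ≤ t ∧
    Real.exp (-∫ r in (0 : ℝ)..t, M.totalRate (h (Fin.last n)).2 (π.act n h r)) ≤ (u : ℝ)}

/-- The kind of the next jump, drawn according to the rates at the jump time. -/
def nextEvent (π : M.ContPolicy) (n : ℕ) (h : Fin (n + 1) → ℝ × M.State) (z : I × I) : MMEvent :=
  M.drawEvent (h (Fin.last n)).2 (π.act n h (M.holdTime π n h z.1)) z.2

/-- The jump times and states up to the `n`-th jump under the policy `π`, starting from `s`. -/
def contHist (π : M.ContPolicy) (s : M.State) (ω : ℕ → I × I) :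
    (n : ℕ) → Fin (n + 1) → ℝ × M.State
  | 0 => fun _ => (0, s)
  | n + 1 =>
    let h := contHist π s ω n
    Fin.snoc (α := fun _ => ℝ × M.State) h
      ((h (Fin.last n)).1 + M.holdTime π n h (ω n).1,
        M.afterEvent (h (Fin.last n)).2 (M.nextEvent π n h (ω n)))

/-- The integral of `e^{-γt} dRₜ` over `(Tₙ, Tₙ₊₁]`. -/
def contEpochReward (π : M.ContPolicy) (s : M.State) (ω : ℕ → I × I) (n : ℕ) : ℝ :=
  let h := M.contHist π s ω n
  let sn := (h (Fin.last n)).2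
  let T := (h (Fin.last n)).1
  let r := M.holdTime π n h (ω n).1
  Real.exp (-M.gamma * (T + r)) * M.eventReward sn (π.act n h r) (M.nextEvent π n h (ω n))
    - ∫ t in T..(T + r), Real.exp (-M.gamma * t) * M.penalty sn

/-- The total discounted reward, the integral of `e^{-γt} dRₜ` over `(0, ∞)`. -/
def contReward (π : M.ContPolicy) (s : M.State) (ω : ℕ → I × I) : ℝ :=
  ∑' n, M.contEpochReward π s ω n

/-- The value of a policy in the continuous-time problem. -/
def contValue (π : M.ContPolicy) (s : M.State) : ℝ :=
  ∫ ω, M.contReward π s ω ∂contMeasure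

/-- The optimal value function of the continuous-time problem. -/
def contOptValue (s : M.State) : ℝ := ⨆ π : M.ContPolicy, M.contValue π s

/-- The stationary Markov policy `π` attains the optimal value from every initial state. -/
def IsContOptimal (π : M.StatPolicy) : Prop := ∀ s, M.contOptValue s = M.contValue π.toCont s

/-! ### The discrete-time problem -/

/-- The time increment `Δ` is so small that the entries of the transition matrix of the mid-price and
the fill probabilities lie in `[0, 1]`. -/
def ValidStep (Δ : ℝ) : Prop :=
  ∀ s a, M.Feasible s a → (M.upRate s.1 a + M.downRate s.1 a) * Δ ≤ 1 ∧
    M.fillRate s.1 a.ask * Δ ≤ 1 ∧ M.fillRate s.1 a.bid * Δ ≤ 1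

/-- An admissible policy in discrete time: the quotes at the stage `i` are a function of the states at
the stages `0, …, i`. -/
structure DiscPolicy where
  act : (i : ℕ) → (Fin (i + 1) → M.State) → Quotes M.NP
  feasible : ∀ i h, M.Feasible (h (Fin.last i)) (act i h)

/-- A stationary Markov policy as an admissible policy in discrete time. -/
def StatPolicy.toDisc {M : MMModel} (π : M.StatPolicy) : M.DiscPolicy where
  act i h := π.act (h (Fin.last i))
  feasible _ _ := π.feasible _

/-- Independent triples of independent uniform variables, one triple for each stage. -/
def discMeasure : Measure (ℕ → I × I × I) :=
  Measure.infinitePi fun _ =>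
    (volume : Measure I).prod ((volume : Measure I).prod (volume : Measure I))

/-- The next mid-price: for `u` uniform it moves up with probability `upRate * Δ`, down with
probability `downRate * Δ`, and stays with the remaining probability. -/
def discNextPrice (Δ : ℝ) (k : M.PriceIdx) (a : Quotes M.NP) (u : ℝ) : M.PriceIdx :=
  if u < M.upRate k a * Δ then M.moveUp k
  else if u < (M.upRate k a + M.downRate k a) * Δ then M.moveDown k
  else k

/-- The fill indicator of an order: for `u` uniform, Bernoulli with parameter `fillRate * Δ`. -/
def discFill (Δ : ℝ) (k : M.PriceIdx) (q : Option (Fin (M.NP + 1))) (u : ℝ) : ℤ :=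
  if u < M.fillRate k q * Δ then 1 else 0

/-- The next state: `Y` becomes `Y - nᵃ + nᵇ`. -/
def discNext (Δ : ℝ) (s : M.State) (a : Quotes M.NP) (z : I × I × I) : M.State :=
  (M.discNextPrice Δ s.1 a z.1,
    M.addInv s.2 (-M.discFill Δ s.1 a.ask z.2.1 + M.discFill Δ s.1 a.bid z.2.2))

/-- The one-stage reward. -/
def discStepReward (Δ : ℝ) (s : M.State) (a : Quotes M.NP) (z : I × I × I) : ℝ :=
  M.sellProfit s a.ask * (M.discFill Δ s.1 a.ask z.2.1 : ℝ)
    + M.buyProfit s a.bid * (M.discFill Δ s.1 a.bid z.2.2 : ℝ)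
    + (M.mid (M.discNextPrice Δ s.1 a z.1) - M.mid s.1) * M.inv s
    - M.penalty s * Δ

/-- The states at the stages `0, …, i` under the policy `π`, starting from `s`. -/
def discHist (Δ : ℝ) (π : M.DiscPolicy) (s : M.State) (ω : ℕ → I × I × I) :
    (i : ℕ) → Fin (i + 1) → M.State
  | 0 => fun _ => s
  | i + 1 =>
    let h := discHist Δ π s ω i
    Fin.snoc (α := fun _ => M.State) h (M.discNext Δ (h (Fin.last i)) (π.act i h) (ω i))

/-- The discounted reward of the stage `i`. -/
def discStageReward (Δ : ℝ) (π : M.DiscPolicy) (s : M.State) (ω : ℕ → I × I × I) (i : ℕ) : ℝ :=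
  let h := M.discHist Δ π s ω i
  Real.exp (-(i * M.gamma * Δ)) * M.discStepReward Δ (h (Fin.last i)) (π.act i h) (ω i)

/-- The total discounted reward. -/
def discReward (Δ : ℝ) (π : M.DiscPolicy) (s : M.State) (ω : ℕ → I × I × I) : ℝ :=
  ∑' i, M.discStageReward Δ π s ω i

/-- The value of a policy in the discrete-time problem. -/
def discValue (Δ : ℝ) (π : M.DiscPolicy) (s : M.State) : ℝ :=
  ∫ ω, M.discReward Δ π s ω ∂discMeasure

/-- The optimal value function of the discrete-time problem. -/
def discOptValue (Δ : ℝ) (s : M.State) : ℝ := ⨆ π : M.DiscPolicy, M.discValue Δ π s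

/-- The stationary Markov policy `π` attains the optimal value from every initial state. -/
def IsDiscOptimal (Δ : ℝ) (π : M.StatPolicy) : Prop :=
  ∀ s, M.discOptValue Δ s = M.discValue Δ π.toDisc s

end MMModel

end

open MeasureTheory
open scoped unitInterval

noncomputable section


/-! Both control problems are instances of one scheme, `DiscountedChain`: a history driven by i.i.d.
noise, bounded rewards, and at each stage a discount factor in [0,1] whose conditional mean is at
most some q < 1. The expected accumulated discount after n stages is then at most qⁿ, which gives
absolute convergence and integrability of the total reward. Telescoping gives verification: if w is
a supersolution of the one-stage inequality up to an error ε, the value is at most w + ε/(1 - q),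
and likewise from below (`integral_tsum_le`, `le_integral_tsum`).

In discrete time a stage is a time step and q = e^{-γΔ}. In continuous time a stage is the epoch
between two jumps. Quotes may change during an epoch, so the jump time τ has a merely measurable
hazard rate ρ; the key is the identity E[e^{-γτ}(1 + γ/ρ(τ))] = 1 (`integral_exp_hazardTime`). It
turns the pointwise inequality Σₑ rate(e)(reward(e) + W(after e)) ≤ (γ + R)W(s) + ψ, with R the
total rate, into a bound by W(s) on the expected payoff of an epoch, however the quotes vary within
it. The Bellman equations themselves are solved by Banach's fixed point theorem on a finite state
space, and a maximizing selector is an optimal stationary policy.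

For convergence, fix a stationary policy. Its continuous-time value V satisfies a linear evaluation
equation, so one discrete stage started from V reproduces V up to O(Δ²). Dividing by 1 - e^{-γΔ},
which is of order Δ, shows that the two values of this policy differ by O(Δ). There are finitely
many stationary policies, so the constant is uniform. If π₀ is the unique optimum, every other
stationary policy loses a fixed positive amount at some state; for small Δ this exceeds the
approximation errors, so only π₀ can be optimal in discrete time. An optimal stationary policy does
exist there, hence it is π₀, and the optimal values are two values of the same policy. The two
Bellman equations never have to be compared directly. -/

/-! ### First jump times with a bounded hazard rate -/

/-- The first time at which the survival function with hazard rate `ρ` falls to the level `u`. -/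
def hazardTime (ρ : ℝ → ℝ) (u : ℝ) : ℝ :=
  sInf {t : ℝ | 0 ≤ t ∧ Real.exp (-∫ r in (0 : ℝ)..t, ρ r) ≤ u}

theorem hazardTime_nonneg (ρ : ℝ → ℝ) (u : ℝ) : 0 ≤ hazardTime ρ u :=
  Real.sInf_nonneg fun _ h => h.1

section Hazard

variable {ρ : ℝ → ℝ} {l L : ℝ}

theorem intervalIntegrable_of_measurable_bounded (hm : Measurable ρ) (hl : ∀ r, l ≤ ρ r)
    (hL : ∀ r, ρ r ≤ L) (a b : ℝ) : IntervalIntegrable ρ volume a b := by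
  rw [intervalIntegrable_iff]
  refine Measure.integrableOn_of_bounded (M := max |l| |L|) (by simp) hm.aestronglyMeasurable ?_
  exact Filter.Eventually.of_forall fun x => abs_le_max_abs_abs (hl x) (hL x)

theorem le_integral_hazard (hm : Measurable ρ) (hl : ∀ r, l ≤ ρ r) (hL : ∀ r, ρ r ≤ L)
    {a b : ℝ} (hab : a ≤ b) : l * (b - a) ≤ ∫ r in a..b, ρ r := by
  have h := intervalIntegral.integral_mono_on hab
    (intervalIntegrable_const (c := l)) (intervalIntegrable_of_measurable_bounded hm hl hL a b)
    fun x _ => hl x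
  simpa [mul_comm] using h

theorem integral_hazard_sub (hm : Measurable ρ) (hl : ∀ r, l ≤ ρ r) (hL : ∀ r, ρ r ≤ L)
    (a b : ℝ) : (∫ r in (0 : ℝ)..b, ρ r) - ∫ r in (0 : ℝ)..a, ρ r = ∫ r in a..b, ρ r :=
  intervalIntegral.integral_interval_sub_left
    (intervalIntegrable_of_measurable_bounded hm hl hL _ _)
    (intervalIntegrable_of_measurable_bounded hm hl hL _ _)

theorem continuous_integral_hazard (hm : Measurable ρ) (hl : ∀ r, l ≤ ρ r) (hL : ∀ r, ρ r ≤ L) :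
    Continuous fun t => ∫ r in (0 : ℝ)..t, ρ r :=
  intervalIntegral.continuous_primitive
    (fun a b => intervalIntegrable_of_measurable_bounded hm hl hL a b) 0

theorem monotone_integral_hazard (hm : Measurable ρ) (h0 : 0 ≤ l) (hl : ∀ r, l ≤ ρ r)
    (hL : ∀ r, ρ r ≤ L) : Monotone fun t => ∫ r in (0 : ℝ)..t, ρ r := by
  intro a b hab
  have h1 := le_integral_hazard hm hl hL hab
  have h2 := integral_hazard_sub hm hl hL a b
  have : 0 ≤ l * (b - a) := mul_nonneg h0 (sub_nonneg.2 hab)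
  simp only
  linarith

/-- The survival function is continuous and nonincreasing, so the infimum is attained. Positivity of
`u` and of the lower bound `l` keeps the set nonempty. -/
theorem hazardTime_le_iff (hm : Measurable ρ) (h0 : 0 < l) (hl : ∀ r, l ≤ ρ r)
    (hL : ∀ r, ρ r ≤ L) {u t : ℝ} (hu : 0 < u) (ht : 0 ≤ t) :
    hazardTime ρ u ≤ t ↔ Real.exp (-∫ r in (0 : ℝ)..t, ρ r) ≤ u := by
  have hbdd : BddBelow {t : ℝ | 0 ≤ t ∧ Real.exp (-∫ r in (0 : ℝ)..t, ρ r) ≤ u} :=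
    ⟨0, fun _ h => h.1⟩
  refine ⟨fun h => ?_, fun h => csInf_le hbdd ⟨ht, h⟩⟩
  have hne : {t : ℝ | 0 ≤ t ∧ Real.exp (-∫ r in (0 : ℝ)..t, ρ r) ≤ u}.Nonempty := by
    -- By this time the integrated hazard is at least |log u|.
    refine ⟨|Real.log u| / l, by positivity, ?_⟩
    rw [← Real.le_log_iff_exp_le hu]
    have h1 := le_integral_hazard hm hl hL (a := 0) (b := |Real.log u| / l) (by positivity)
    rw [sub_zero, mul_div_cancel₀ _ h0.ne'] at h1
    linarith [neg_abs_le (Real.log u)]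
  have hcl : IsClosed {t : ℝ | 0 ≤ t ∧ Real.exp (-∫ r in (0 : ℝ)..t, ρ r) ≤ u} :=
    isClosed_Ici.inter (isClosed_le
      (Real.continuous_exp.comp (continuous_integral_hazard hm hl hL).neg) continuous_const)
  have hmem := hcl.csInf_mem hne hbdd
  refine le_trans ?_ hmem.2
  exact Real.exp_le_exp.2 (neg_le_neg (monotone_integral_hazard hm h0.le hl hL h))

/-- The level 0 is never reached, and `sInf ∅ = 0`. This null case has to be carried along in the
measurability proof. -/
theorem hazardTime_zero (ρ : ℝ → ℝ) : hazardTime ρ 0 = 0 := by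
  simp [hazardTime, not_le.2 (Real.exp_pos _)]

/-- Integral of the density of a first jump time. -/
theorem integral_hazard_mul_exp (hm : Measurable ρ) (h0 : 0 ≤ l) (hl : ∀ r, l ≤ ρ r)
    (hL : ∀ r, ρ r ≤ L) {t : ℝ} (ht : 0 ≤ t) :
    ∫ x in (0 : ℝ)..t, ρ x * Real.exp (-∫ r in (0 : ℝ)..x, ρ r)
      = 1 - Real.exp (-∫ r in (0 : ℝ)..t, ρ r) := by
  have hR : ∀ x, 0 ≤ x → 0 ≤ ∫ r in (0 : ℝ)..x, ρ r := fun x hx => by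
    simpa using monotone_integral_hazard hm h0 hl hL hx
  have hii := intervalIntegrable_of_measurable_bounded hm hl hL 0 t
  have hL0 : 0 ≤ L := h0.trans ((hl 0).trans (hL 0))
  -- Since ρ is only measurable, the survival function is differentiable merely almost everywhere.
  -- Being Lipschitz it is absolutely continuous, so it is still the integral of its derivative.
  have hlip : LipschitzOnWith (Real.toNNReal L)
      (fun x => Real.exp (-∫ r in (0 : ℝ)..x, ρ r)) (Set.uIcc 0 t) := by
    refine LipschitzOnWith.of_le_add_mul _ fun x hx y hy => ?_
    rw [Set.uIcc_of_le ht] at hx hy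
    rw [Real.coe_toNNReal _ hL0, Real.dist_eq]
    rcases le_total y x with h | h
    · have := monotone_integral_hazard hm h0 hl hL h
      have := Real.exp_le_exp.2 (neg_le_neg this)
      have : 0 ≤ L * |x - y| := by positivity
      linarith
    · have h1 : (∫ r in x..y, ρ r) ≤ L * |x - y| := by
        have := intervalIntegral.norm_integral_le_of_norm_le_const (f := ρ) (a := x) (b := y)
          (C := L) fun r _ => by
            rw [Real.norm_of_nonneg (h0.trans (hl r))]; exact hL r
        rw [abs_sub_comm]
        exact (le_abs_self _).trans this
      have h2 := integral_hazard_sub hm hl hL x y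
      have h3 := hR x hx.1
      have h4 : Real.exp (-∫ r in (0 : ℝ)..y, ρ r)
          = Real.exp (-∫ r in (0 : ℝ)..x, ρ r) * Real.exp (-∫ r in x..y, ρ r) := by
        rw [← Real.exp_add]; congr 1; linarith
      have h5 : 1 - (∫ r in x..y, ρ r) ≤ Real.exp (-∫ r in x..y, ρ r) := by
        linarith [Real.add_one_le_exp (-∫ r in x..y, ρ r)]
      have h6 : Real.exp (-∫ r in (0 : ℝ)..x, ρ r) ≤ 1 := Real.exp_le_one_iff.2 (by linarith)
      have h7 := Real.exp_pos (-∫ r in (0 : ℝ)..x, ρ r)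
      have h8 : 0 ≤ ∫ r in x..y, ρ r := by
        have := monotone_integral_hazard hm h0 hl hL h
        simp only at this
        linarith
      rw [h4]
      nlinarith
  have h := hlip.absolutelyContinuousOnInterval.integral_deriv_eq_sub
  simp only [intervalIntegral.integral_same, neg_zero, Real.exp_zero] at h
  rw [← neg_sub, ← h, ← intervalIntegral.integral_neg]
  refine intervalIntegral.integral_congr_ae ?_
  filter_upwards [hii.ae_hasDerivAt_integral] with x hx hxt
  have h1 := hx (Set.uIoc_subset_uIcc hxt) 0 (by simp)
  have h2 : deriv (fun y => Real.exp (-∫ r in (0 : ℝ)..y, ρ r)) x = _ := h1.neg.exp.deriv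
  rw [h2]
  simp only [Pi.neg_apply]
  ring

/-- Inverse transform sampling: the distribution functions agree, because τ ≤ t means that u is at
least the survival probability at t, and the density integrates to one minus that probability. -/
theorem map_hazardTime (hm : Measurable ρ) (h0 : 0 < l) (hl : ∀ r, l ≤ ρ r)
    (hL : ∀ r, ρ r ≤ L) (hτ : Measurable fun u : I => hazardTime ρ u) :
    (volume : Measure I).map (fun u : I => hazardTime ρ u) =
      (volume.restrict (Set.Ioi (0 : ℝ))).withDensity
        fun x => ENNReal.ofReal (ρ x * Real.exp (-∫ r in (0 : ℝ)..x, ρ r)) := by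
  have : IsProbabilityMeasure ((volume : Measure I).map fun u : I => hazardTime ρ u) :=
    Measure.isProbabilityMeasure_map hτ.aemeasurable
  refine Measure.ext_of_Iic _ _ fun t => ?_
  rw [Measure.map_apply hτ measurableSet_Iic, withDensity_apply _ measurableSet_Iic,
    Measure.restrict_restrict measurableSet_Iic, Set.Iic_inter_Ioi]
  rcases lt_or_ge t 0 with ht | ht
  · rw [Set.Ioc_eq_empty (by linarith)]
    have : (fun u : I => hazardTime ρ u) ⁻¹' Set.Iic t = ∅ := by
      ext u
      simpa using ht.trans_le (hazardTime_nonneg ρ u)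
    simp [this]
  · have hR : 0 ≤ ∫ r in (0 : ℝ)..t, ρ r := by
      simpa using monotone_integral_hazard hm h0.le hl hL ht
    let e : I := ⟨Real.exp (-∫ r in (0 : ℝ)..t, ρ r),
      (Real.exp_pos _).le, Real.exp_le_one_iff.2 (by linarith)⟩
    have hset : (fun u : I => hazardTime ρ u) ⁻¹' Set.Iic t =ᵐ[volume] Set.Ici e := by
      have hz : ∀ᵐ u : I, u ≠ 0 := by simp [ae_iff, measure_singleton]
      filter_upwards [hz] with u hu
      have hu' : 0 < (u : ℝ) := unitInterval.pos_iff_ne_zero.2 hu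
      exact propext ((hazardTime_le_iff hm h0 hl hL hu' ht).trans Iff.rfl)
    rw [measure_congr hset, unitInterval.volume_Ici, ← ofReal_integral_eq_lintegral_ofReal,
      ← intervalIntegral.integral_of_le ht, integral_hazard_mul_exp hm h0.le hl hL ht]
    · exact (intervalIntegrable_iff_integrableOn_Ioc_of_le ht).1 <|
        (intervalIntegrable_of_measurable_bounded hm hl hL 0 t).mul_continuousOn
        (Real.continuous_exp.comp (continuous_integral_hazard hm hl hL).neg).continuousOn
    · exact Filter.Eventually.of_forall fun x =>
        mul_nonneg (h0.le.trans (hl x)) (Real.exp_pos _).le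

/-- Joint measurability in the history and the noise: `hazardTime_le_iff` describes the sublevel
sets through a parametric integral, apart from the level u = 0. -/
theorem measurable_hazardTime {α : Type*} [MeasurableSpace α] {ρ : α → ℝ → ℝ}
    (hm : Measurable fun p : α × ℝ => ρ p.1 p.2) (h0 : 0 < l)
    (hl : ∀ a r, l ≤ ρ a r) (hL : ∀ a r, ρ a r ≤ L) :
    Measurable fun p : α × I => hazardTime (ρ p.1) p.2 := by
  refine measurable_of_Iic fun t => ?_
  have hma : ∀ a, Measurable (ρ a) := fun a => hm.comp (measurable_const.prodMk measurable_id)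
  rcases lt_or_ge t 0 with ht | ht
  · convert! MeasurableSet.empty
    ext p
    simpa using ht.trans_le (hazardTime_nonneg _ _)
  · have hset : (fun p : α × I => hazardTime (ρ p.1) p.2) ⁻¹' Set.Iic t
        = {p | (p.2 : ℝ) = 0} ∪ {p | Real.exp (-∫ r in (0 : ℝ)..t, ρ p.1 r) ≤ (p.2 : ℝ)} := by
      ext ⟨a, u⟩
      rcases eq_or_lt_of_le u.2.1 with h | h
      · have hu : u = 0 := Subtype.ext h.symm
        simp [hu, hazardTime_zero, ht]
      · simp only [Set.mem_preimage, Set.mem_Iic, Set.mem_union, Set.mem_ofPred_eq, h.ne', false_or]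
        exact hazardTime_le_iff (hma a) h0 (hl a) (hL a) h ht
    have hint : Measurable fun a => ∫ r in (0 : ℝ)..t, ρ a r := by
      simp only [intervalIntegral.integral_of_le ht]
      exact (hm.stronglyMeasurable.integral_prod_right
        (ν := volume.restrict (Set.Ioc 0 t))).measurable
    rw [hset]
    refine MeasurableSet.union ?_ ?_
    · exact (measurable_subtype_coe.comp measurable_snd) (measurableSet_singleton 0)
    · exact measurableSet_le (hint.comp measurable_fst).neg.exp
        (measurable_subtype_coe.comp measurable_snd)

theorem measurable_hazardTime_of_rate (hm : Measurable ρ) (h0 : 0 < l) (hl : ∀ r, l ≤ ρ r)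
    (hL : ∀ r, ρ r ≤ L) : Measurable fun u : I => hazardTime ρ u :=
  (measurable_hazardTime (α := Unit) (ρ := fun _ => ρ) (hm.comp measurable_snd) h0
    (fun _ => hl) (fun _ => hL)).comp (measurable_const (a := ()) |>.prodMk measurable_id)

theorem integral_hazardTime (hm : Measurable ρ) (h0 : 0 < l) (hl : ∀ r, l ≤ ρ r)
    (hL : ∀ r, ρ r ≤ L) {g : ℝ → ℝ} (hg : Measurable g) :
    ∫ u : I, g (hazardTime ρ u) =
      ∫ x in Set.Ioi (0 : ℝ), ρ x * Real.exp (-∫ r in (0 : ℝ)..x, ρ r) * g x := by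
  have hτ : Measurable fun u : I => hazardTime ρ u :=
    measurable_hazardTime_of_rate hm h0 hl hL
  have hd : Measurable fun x => ρ x * Real.exp (-∫ r in (0 : ℝ)..x, ρ r) :=
    hm.mul (Real.continuous_exp.comp (continuous_integral_hazard hm hl hL).neg).measurable
  rw [← integral_map (μ := (volume : Measure I)) (φ := fun u : I => hazardTime ρ u) (f := g)
    hτ.aemeasurable hg.aestronglyMeasurable, map_hazardTime hm h0 hl hL hτ,
    integral_withDensity_eq_integral_toReal_smul hd.ennreal_ofReal (by simp)]
  refine integral_congr_ae (Filter.Eventually.of_forall fun x => ?_)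
  simp only [smul_eq_mul]
  rw [ENNReal.toReal_ofReal (mul_nonneg (h0.le.trans (hl x)) (Real.exp_pos _).le)]

/-- A resolvent identity for the first jump time. -/
theorem integral_exp_hazardTime (hm : Measurable ρ) (h0 : 0 < l) (hl : ∀ r, l ≤ ρ r)
    (hL : ∀ r, ρ r ≤ L) {γ : ℝ} (hγ : 0 < γ) :
    ∫ u : I, Real.exp (-γ * hazardTime ρ u) * (1 + γ / ρ (hazardTime ρ u)) = 1 := by
  have h1 := integral_hazardTime hm h0 hl hL
    (g := fun t => Real.exp (-γ * t) * (1 + γ / ρ t)) (by fun_prop)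
  -- With an independent killing at rate γ the hazard becomes ρ + γ; the identity says that the
  -- density of this killed clock has total mass one.
  have h2 := integral_hazardTime (ρ := fun r => ρ r + γ) (hm.add_const γ) h0
    (fun r => by linarith [hl r]) (fun r => add_le_add_left (hL r) γ) (g := fun _ => 1)
    measurable_const
  simp only [integral_const, probReal_univ, smul_eq_mul, mul_one] at h2
  refine h1.trans (Eq.trans ?_ h2.symm)
  refine integral_congr_ae (Filter.Eventually.of_forall fun x => ?_)
  have hx : ρ x ≠ 0 := (h0.trans_le (hl x)).ne'
  simp only
  rw [intervalIntegral.integral_add (intervalIntegrable_of_measurable_bounded hm hl hL 0 x)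
    intervalIntegrable_const, intervalIntegral.integral_const, neg_add, Real.exp_add, sub_zero,
    smul_eq_mul, show -γ * x = -(x * γ) by ring]
  field_simp

end Hazard


/-! ### Bellman equations on finite state spaces -/

/-- The operator that maximizes `Q` over the feasible actions is a contraction of the sup norm; its
fixed point is `W`, and `π` selects a maximizer. -/
theorem exists_bellman_solution {S A : Type*} [Finite S] (Q : S → A → (S → ℝ) → ℝ)
    (feas : S → Set A) (hfin : ∀ s, (feas s).Finite) (hne : ∀ s, (feas s).Nonempty)
    {q : ℝ} (hq0 : 0 ≤ q) (hq1 : q < 1)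
    (hQ : ∀ s, ∀ a ∈ feas s, ∀ (W W' : S → ℝ) (b : ℝ), (∀ s, |W s - W' s| ≤ b) →
      |Q s a W - Q s a W'| ≤ q * b) :
    ∃ (W : S → ℝ) (π : S → A), (∀ s, π s ∈ feas s) ∧ (∀ s, Q s (π s) W = W s) ∧
      ∀ s, ∀ a ∈ feas s, Q s a W ≤ W s := by
  cases nonempty_fintype S
  have hmax : ∀ (W : S → ℝ) (s : S), ∃ a ∈ feas s, ∀ a' ∈ feas s, Q s a' W ≤ Q s a W :=
    fun W s => Set.exists_max_image (feas s) (fun a => Q s a W) (hfin s) (hne s)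
  choose m hm hmle using hmax
  -- The maximizer for `W` is a competitor in the maximum for `W'`; exchanging the two functions
  -- gives the other bound.
  have hone : ∀ (W W' : S → ℝ) (s : S), Q s (m W s) W - Q s (m W' s) W' ≤ q * dist W W' := by
    intro W W' s
    have h1 := hQ s _ (hm W s) W W' (dist W W') fun s => dist_le_pi_dist W W' s
    have h2 := hmle W' s _ (hm W s)
    linarith [le_abs_self (Q s (m W s) W - Q s (m W s) W')]
  have hc : ContractingWith ⟨q, hq0⟩ fun (W : S → ℝ) s => Q s (m W s) W := by
    refine ⟨hq1, LipschitzWith.of_dist_le_mul fun W W' => ?_⟩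
    refine (dist_pi_le_iff (mul_nonneg hq0 dist_nonneg)).2 fun s => ?_
    rw [Real.dist_eq, abs_le]
    have h1 := hone W W' s
    have h2 := hone W' W s
    rw [dist_comm] at h2
    exact ⟨neg_le.1 (by rwa [neg_sub]), h1⟩
  have hfix : (fun s => Q s (m hc.fixedPoint s) hc.fixedPoint) = hc.fixedPoint :=
    hc.fixedPoint_isFixedPt
  exact ⟨hc.fixedPoint, m hc.fixedPoint, hm _, fun s => congrFun hfix s,
    fun s a ha => (hmle _ s a ha).trans_eq (congrFun hfix s)⟩

/-! ### Sequences driven by independent noise -/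

theorem measurable_update_prod {Z : Type*} [MeasurableSpace Z] (n : ℕ) :
    Measurable fun p : (ℕ → Z) × Z => Function.update p.1 n p.2 := by
  refine measurable_pi_lambda _ fun i => ?_
  by_cases hi : i = n
  · subst hi; simpa using measurable_snd
  · simpa [hi, Function.comp_def] using (measurable_pi_apply i).comp (measurable_fst (β := Z))

section Product

variable {Z : Type*} [MeasurableSpace Z] (μ : Measure Z) [IsProbabilityMeasure μ]

/-- Resampling one coordinate leaves the product measure invariant. -/
theorem map_update_infinitePi (n : ℕ) :
    ((Measure.infinitePi fun _ : ℕ => μ).prod μ).map (fun p => Function.update p.1 n p.2) =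
      Measure.infinitePi fun _ : ℕ => μ := by
  have hmeas : Measurable fun p : (ℕ → Z) × Z => Function.update p.1 n p.2 :=
    measurable_update_prod n
  refine Measure.eq_infinitePi (μ := fun _ : ℕ => μ) fun s t ht => ?_
  rw [Measure.map_apply hmeas (MeasurableSet.pi s.countable_toSet fun i _ => ht i)]
  have hset : (fun p : (ℕ → Z) × Z => Function.update p.1 n p.2) ⁻¹' Set.pi s t
      = (Set.pi (s.erase n : Finset ℕ) t) ×ˢ (if n ∈ s then t n else Set.univ) := by
    ext ⟨ω, z⟩
    simp only [Set.mem_preimage, Set.mem_pi, Finset.mem_coe, Set.mem_prod, Finset.mem_erase]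
    constructor
    · intro h
      refine ⟨fun i hi => by simpa [hi.1] using h i hi.2, ?_⟩
      split_ifs with hn
      · simpa using h n hn
      · trivial
    · rintro ⟨h1, h2⟩ i hi
      by_cases hin : i = n
      · subst hin; simpa [hi] using h2
      · simpa [hin] using h1 i ⟨hin, hi⟩
  rw [hset, Measure.prod_prod, Measure.infinitePi_pi _ fun i _ => ht i]
  split_ifs with hn
  · exact Finset.prod_erase_mul s (fun i => μ (t i)) hn
  · rw [measure_univ, mul_one, Finset.erase_eq_of_notMem hn]

variable {μ}

/-- This replaces conditioning on the past: resampling the n-th coordinate changes neither the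
measure nor `X`, which looks only at earlier coordinates, so Fubini applies. -/
theorem integral_infinitePi_of_dependsOn {E : Type*} [MeasurableSpace E] {n : ℕ}
    {X : (ℕ → Z) → E} (hX : Measurable X) (hdep : DependsOn X (Set.Iio n)) {f : E → Z → ℝ}
    (hf : Measurable (Function.uncurry f)) {b : ℝ} (hb : ∀ ω z, |f (X ω) z| ≤ b) :
    ∫ ω, f (X ω) (ω n) ∂(Measure.infinitePi fun _ : ℕ => μ) =
      ∫ ω, ∫ z, f (X ω) z ∂μ ∂(Measure.infinitePi fun _ : ℕ => μ) := by
  have hmeas : Measurable fun p : (ℕ → Z) × Z => Function.update p.1 n p.2 :=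
    measurable_update_prod n
  have hg : Measurable fun ω : ℕ → Z => f (X ω) (ω n) :=
    hf.comp (hX.prodMk (measurable_pi_apply n))
  conv_lhs => rw [← map_update_infinitePi μ n]
  rw [integral_map hmeas.aemeasurable hg.aestronglyMeasurable]
  have hXu : ∀ (ω : ℕ → Z) z, X (Function.update ω n z) = X ω := fun ω z =>
    hdep fun i hi => Function.update_of_ne (Set.mem_Iio.1 hi).ne _ _
  simp only [hXu, Function.update_self]
  refine integral_prod (fun p : (ℕ → Z) × Z => f (X p.1) p.2) ?_
  refine Integrable.of_bound (C := b)
    (hf.comp ((hX.comp measurable_fst).prodMk measurable_snd)).aestronglyMeasurable ?_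
  exact Filter.Eventually.of_forall fun p => hb p.1 p.2

end Product

/-- A sequence of histories driven by independent noise, with bounded rewards and a random discount
factor at each stage. -/
structure DiscountedChain {Z : Type*} [MeasurableSpace Z] (μ : Measure Z) where
  H : ℕ → Type
  [mH : ∀ n, MeasurableSpace (H n)]
  next : ∀ n, H n → Z → H (n + 1)
  init : H 0
  acc : ∀ n, H n → ℝ
  disc : ∀ n, H n → Z → ℝ
  rew : ∀ n, H n → Z → ℝ
  q : ℝ
  K : ℝ
  measurable_next : ∀ n, Measurable (Function.uncurry (next n))
  measurable_acc : ∀ n, Measurable (acc n)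
  measurable_disc : ∀ n, Measurable (Function.uncurry (disc n))
  measurable_rew : ∀ n, Measurable (Function.uncurry (rew n))
  acc_init : acc 0 init = 1
  acc_next : ∀ n h z, acc (n + 1) (next n h z) = acc n h * disc n h z
  disc_nonneg : ∀ n h z, 0 ≤ disc n h z
  disc_le_one : ∀ n h z, disc n h z ≤ 1
  -- Only a bound in the mean is asked for: times between jumps can be arbitrarily short, so there
  -- the discount factors have no pathwise bound below one.
  integral_disc_le : ∀ n h, ∫ z, disc n h z ∂μ ≤ q
  q_lt_one : q < 1
  abs_rew_le : ∀ n h z, |rew n h z| ≤ K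

/-! ### Convergence and verification for discounted chains -/

namespace DiscountedChain

variable {Z : Type*} [MeasurableSpace Z] {μ : Measure Z} (C : DiscountedChain μ)

attribute [instance] DiscountedChain.mH

/-- The history after `n` stages. -/
def hist (ω : ℕ → Z) : (n : ℕ) → C.H n
  | 0 => C.init
  | n + 1 => C.next n (hist ω n) (ω n)

/-- The discounted reward of the stage `n`. -/
def stageReward (n : ℕ) (ω : ℕ → Z) : ℝ := C.acc n (C.hist ω n) * C.rew n (C.hist ω n) (ω n)

theorem measurable_hist (n : ℕ) : Measurable fun ω => C.hist ω n := by
  induction n with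
  | zero => exact measurable_const
  | succ n ih => exact (C.measurable_next n).comp (ih.prodMk (measurable_pi_apply n))

theorem dependsOn_hist (n : ℕ) : DependsOn (fun ω => C.hist ω n) (Set.Iio n) := by
  induction n with
  | zero => exact fun _ _ _ => rfl
  | succ n ih =>
    intro ω ω' h
    have h1 : C.hist ω n = C.hist ω' n := ih fun i hi => h i (Nat.lt_succ_of_lt hi)
    change C.next n (C.hist ω n) (ω n) = C.next n (C.hist ω' n) (ω' n)
    rw [h1, h n (Nat.lt_succ_self n)]

theorem acc_hist_nonneg (ω : ℕ → Z) (n : ℕ) : 0 ≤ C.acc n (C.hist ω n) := by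
  induction n with
  | zero => exact C.acc_init.symm ▸ zero_le_one
  | succ n ih => exact (C.acc_next n _ _).symm ▸ mul_nonneg ih (C.disc_nonneg n _ _)

theorem acc_hist_le_one (ω : ℕ → Z) (n : ℕ) : C.acc n (C.hist ω n) ≤ 1 := by
  induction n with
  | zero => exact C.acc_init.le
  | succ n ih =>
    exact (C.acc_next n _ _).symm ▸
      mul_le_one₀ ih (C.disc_nonneg n _ _) (C.disc_le_one n _ _)

theorem abs_acc_mul_le {ω : ℕ → Z} {n : ℕ} {x b : ℝ} (hx : |x| ≤ b) :
    |C.acc n (C.hist ω n) * x| ≤ b := by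
  rw [abs_mul, abs_of_nonneg (C.acc_hist_nonneg ω n)]
  exact (mul_le_mul (C.acc_hist_le_one ω n) hx (abs_nonneg _) zero_le_one).trans_eq (one_mul b)

theorem q_nonneg : 0 ≤ C.q :=
  (integral_nonneg fun z => C.disc_nonneg 0 C.init z).trans (C.integral_disc_le 0 C.init)

theorem abs_disc_le (n : ℕ) (h : C.H n) (z : Z) : |C.disc n h z| ≤ 1 := by
  rw [abs_of_nonneg (C.disc_nonneg n h z)]; exact C.disc_le_one n h z

theorem measurable_rew_hist (n : ℕ) : Measurable fun ω => C.rew n (C.hist ω n) (ω n) :=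
  (C.measurable_rew n).comp ((C.measurable_hist n).prodMk (measurable_pi_apply n))

theorem measurable_stageReward (n : ℕ) : Measurable (C.stageReward n) :=
  ((C.measurable_acc n).comp (C.measurable_hist n)).mul (C.measurable_rew_hist n)

variable [IsProbabilityMeasure μ]

theorem integral_acc_mul {n : ℕ} {f : C.H n → Z → ℝ} (hf : Measurable (Function.uncurry f))
    {b : ℝ} (hb : ∀ h z, |f h z| ≤ b) :
    ∫ ω, C.acc n (C.hist ω n) * f (C.hist ω n) (ω n) ∂(Measure.infinitePi fun _ : ℕ => μ) =
      ∫ ω, C.acc n (C.hist ω n) * ∫ z, f (C.hist ω n) z ∂μ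
        ∂(Measure.infinitePi fun _ : ℕ => μ) := by
  rw [integral_infinitePi_of_dependsOn (C.measurable_hist n) (C.dependsOn_hist n)
    (f := fun h z => C.acc n h * f h z) (((C.measurable_acc n).comp measurable_fst).mul hf)
    (fun ω z => C.abs_acc_mul_le (hb _ z))]
  simp only [integral_const_mul]

theorem integrable_acc_mul {n : ℕ} {g : (ℕ → Z) → ℝ} (hg : Measurable g)
    {b : ℝ} (hb : ∀ ω, |g ω| ≤ b) :
    Integrable (fun ω => C.acc n (C.hist ω n) * g ω) (Measure.infinitePi fun _ : ℕ => μ) :=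
  Integrable.of_bound (C := b)
    (((C.measurable_acc n).comp (C.measurable_hist n)).mul hg).aestronglyMeasurable
    (Filter.Eventually.of_forall fun ω => C.abs_acc_mul_le (hb ω))

theorem measurable_integral {n : ℕ} {f : C.H n → Z → ℝ} (hf : Measurable (Function.uncurry f)) :
    Measurable fun ω : ℕ → Z => ∫ z, f (C.hist ω n) z ∂μ :=
  hf.stronglyMeasurable.integral_prod_right.measurable.comp (C.measurable_hist n)

theorem abs_integral_le {n : ℕ} {f : C.H n → Z → ℝ} {b : ℝ} (hb : ∀ h z, |f h z| ≤ b)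
    (h : C.H n) : |∫ z, f h z ∂μ| ≤ b := by
  have := norm_integral_le_of_norm_le_const (μ := μ) (f := f h) (C := b)
    (Filter.Eventually.of_forall fun z => hb h z)
  simpa using this

/-- Averaging over the noise of the last stage costs a factor `q`. All convergence and integrability
statements about the total reward rest on this geometric decay. -/
theorem integral_acc_le (n : ℕ) :
    ∫ ω, C.acc n (C.hist ω n) ∂(Measure.infinitePi fun _ : ℕ => μ) ≤ C.q ^ n := by
  induction n with
  | zero => simp [hist, C.acc_init]
  | succ n ih =>
    simp only [hist, C.acc_next]
    rw [C.integral_acc_mul (C.measurable_disc n) (C.abs_disc_le n), pow_succ]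
    refine le_trans ?_ (mul_le_mul_of_nonneg_right ih C.q_nonneg)
    rw [← integral_mul_const]
    refine integral_mono ?_ ?_ fun ω =>
      mul_le_mul_of_nonneg_left (C.integral_disc_le n _) (C.acc_hist_nonneg ω n)
    · exact C.integrable_acc_mul (C.measurable_integral (C.measurable_disc n))
        (fun ω => C.abs_integral_le (C.abs_disc_le n) _)
    · exact C.integrable_acc_mul (g := fun _ => C.q) measurable_const (fun _ => le_rfl)

theorem integrable_stageReward (n : ℕ) :
    Integrable (C.stageReward n) (Measure.infinitePi fun _ : ℕ => μ) :=
  C.integrable_acc_mul (C.measurable_rew_hist n) (fun _ => C.abs_rew_le n _ _)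

theorem integral_norm_stageReward_le (n : ℕ) :
    ∫ ω, ‖C.stageReward n ω‖ ∂(Measure.infinitePi fun _ : ℕ => μ) ≤ C.K * C.q ^ n := by
  have hK : 0 ≤ C.K := by
    obtain ⟨z⟩ : Nonempty Z := nonempty_of_isProbabilityMeasure μ
    exact (abs_nonneg _).trans (C.abs_rew_le 0 C.init z)
  refine le_trans ?_ (mul_le_mul_of_nonneg_left (C.integral_acc_le n) hK)
  rw [← integral_const_mul]
  refine integral_mono (C.integrable_stageReward n).norm ?_ fun ω => ?_
  · have := C.integrable_acc_mul (μ := μ) (n := n) (g := fun _ => C.K) measurable_const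
      (fun _ => le_rfl)
    simpa only [mul_comm] using this
  · simp only [stageReward, Real.norm_eq_abs]
    rw [abs_mul, abs_of_nonneg (C.acc_hist_nonneg ω n), mul_comm]
    exact mul_le_mul_of_nonneg_right (C.abs_rew_le n _ _) (C.acc_hist_nonneg ω n)

theorem summable_integral_norm :
    Summable fun n => ∫ ω, ‖C.stageReward n ω‖ ∂(Measure.infinitePi fun _ : ℕ => μ) :=
  Summable.of_nonneg_of_le (fun _ => integral_nonneg fun _ => norm_nonneg _)
    C.integral_norm_stageReward_le
    ((summable_geometric_of_lt_one C.q_nonneg C.q_lt_one).mul_left _)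

theorem lintegral_tsum_lt_top :
    ∫⁻ ω, ∑' n, ‖C.stageReward n ω‖ₑ ∂(Measure.infinitePi fun _ : ℕ => μ) < ⊤ := by
  rw [lintegral_tsum fun n => (C.integrable_stageReward n).1.enorm]
  have h : ∀ n, ∫⁻ ω, ‖C.stageReward n ω‖ₑ ∂(Measure.infinitePi fun _ : ℕ => μ) =
      ENNReal.ofReal (∫ ω, ‖C.stageReward n ω‖ ∂(Measure.infinitePi fun _ : ℕ => μ)) := fun n =>
    (ofReal_integral_norm_eq_lintegral_enorm (C.integrable_stageReward n)).symm
  simp only [h]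
  rw [← ENNReal.ofReal_tsum_of_nonneg (fun _ => integral_nonneg fun _ => norm_nonneg _)
    C.summable_integral_norm]
  exact ENNReal.ofReal_lt_top

theorem ae_summable_stageReward :
    ∀ᵐ ω ∂(Measure.infinitePi fun _ : ℕ => μ), Summable fun n => C.stageReward n ω := by
  have h := ae_lt_top' (AEMeasurable.tsum fun n => (C.integrable_stageReward n).1.enorm)
    C.lintegral_tsum_lt_top.ne
  filter_upwards [h] with ω hω
  have h2 : Summable fun n => ‖C.stageReward n ω‖₊ :=
    ENNReal.tsum_coe_ne_top_iff_summable.1 hω.ne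
  exact Summable.of_norm (NNReal.summable_coe.2 h2)

theorem integrable_tsum_stageReward :
    Integrable (fun ω => ∑' n, C.stageReward n ω) (Measure.infinitePi fun _ : ℕ => μ) := by
  refine ⟨?_, ?_⟩
  · refine aestronglyMeasurable_of_tendsto_ae (u := Filter.atTop)
      (f := fun N ω => ∑ n ∈ Finset.range N, C.stageReward n ω)
      (fun N => (Finset.measurable_fun_sum _ fun n _ =>
        C.measurable_stageReward n).aestronglyMeasurable) ?_
    filter_upwards [C.ae_summable_stageReward] with ω hω
    exact hω.hasSum.tendsto_sum_nat
  · refine (lintegral_mono_ae ?_).trans_lt C.lintegral_tsum_lt_top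
    exact Filter.Eventually.of_forall fun ω => enorm_tsum_le_tsum_enorm

/-- Verification argument: weighted by the accumulated discount, the stage inequalities telescope.
The error of stage n enters with weight at most qⁿ, whence ε/(1 - q), and the terminal term is at
most b qᴺ. -/
theorem integral_tsum_le {w : ∀ n, C.H n → ℝ} (hw : ∀ n, Measurable (w n)) {b ε : ℝ}
    (hb : ∀ n h, |w n h| ≤ b) (hε : 0 ≤ ε)
    (hstep : ∀ n h, ∫ z, (C.rew n h z + C.disc n h z * w (n + 1) (C.next n h z)) ∂μ
      ≤ w n h + ε) :
    ∫ ω, ∑' n, C.stageReward n ω ∂(Measure.infinitePi fun _ : ℕ => μ) ≤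
      w 0 C.init + ε / (1 - C.q) := by
  set P := Measure.infinitePi fun _ : ℕ => μ
  have hsum := hasSum_integral_of_summable_integral_norm (F := C.stageReward)
    C.integrable_stageReward C.summable_integral_norm
  have hb0 : 0 ≤ b := (abs_nonneg _).trans (hb 0 C.init)
  have h1q : 0 < 1 - C.q := sub_pos.2 C.q_lt_one
  have hmw : ∀ n, Measurable fun ω : ℕ → Z => w n (C.hist ω n) :=
    fun n => (hw n).comp (C.measurable_hist n)
  have hint : ∀ n, Integrable (fun ω => C.acc n (C.hist ω n) * w n (C.hist ω n)) P :=
    fun n => C.integrable_acc_mul (hmw n) fun ω => hb n _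
  have hone : ∀ n, ∫ ω, C.stageReward n ω ∂P ≤
      (∫ ω, C.acc n (C.hist ω n) * w n (C.hist ω n) ∂P)
        - (∫ ω, C.acc (n + 1) (C.hist ω (n + 1)) * w (n + 1) (C.hist ω (n + 1)) ∂P)
        + ε * C.q ^ n := by
    intro n
    have hmf : Measurable (Function.uncurry fun h z =>
        C.rew n h z + C.disc n h z * w (n + 1) (C.next n h z)) :=
      (C.measurable_rew n).add
        ((C.measurable_disc n).mul ((hw (n + 1)).comp (C.measurable_next n)))
    have hbf : ∀ h z, |C.rew n h z + C.disc n h z * w (n + 1) (C.next n h z)| ≤ C.K + b := by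
      intro h z
      refine (abs_add_le _ _).trans (add_le_add (C.abs_rew_le n h z) ?_)
      rw [abs_mul]
      exact (mul_le_mul (C.abs_disc_le n h z) (hb _ _) (abs_nonneg _) zero_le_one).trans_eq
        (one_mul b)
    have e1 := C.integral_acc_mul hmf hbf
    have e2 : ∫ ω, C.acc n (C.hist ω n) * (C.rew n (C.hist ω n) (ω n)
        + C.disc n (C.hist ω n) (ω n) * w (n + 1) (C.next n (C.hist ω n) (ω n))) ∂P
        = (∫ ω, C.stageReward n ω ∂P) +
          ∫ ω, C.acc (n + 1) (C.hist ω (n + 1)) * w (n + 1) (C.hist ω (n + 1)) ∂P := by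
      rw [← integral_add (C.integrable_stageReward n) (hint (n + 1))]
      refine integral_congr_ae (Filter.Eventually.of_forall fun ω => ?_)
      simp only [stageReward, hist, C.acc_next]
      ring
    have e3 : ∫ ω, C.acc n (C.hist ω n) * ∫ z, (C.rew n (C.hist ω n) z
        + C.disc n (C.hist ω n) z * w (n + 1) (C.next n (C.hist ω n) z)) ∂μ ∂P
        ≤ (∫ ω, C.acc n (C.hist ω n) * w n (C.hist ω n) ∂P)
          + ∫ ω, C.acc n (C.hist ω n) * ε ∂P := by
      have hie : Integrable (fun ω => C.acc n (C.hist ω n) * ε) P :=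
        C.integrable_acc_mul (g := fun _ => ε) measurable_const fun _ => le_rfl
      rw [← integral_add (hint n) hie]
      refine integral_mono ?_ ((hint n).add hie) fun ω => ?_
      · exact C.integrable_acc_mul (C.measurable_integral hmf) fun ω => C.abs_integral_le hbf _
      · simp only [← mul_add]
        exact mul_le_mul_of_nonneg_left (hstep n _) (C.acc_hist_nonneg ω n)
    rw [integral_mul_const] at e3
    have e4 := mul_le_mul_of_nonneg_right (C.integral_acc_le (μ := μ) n) hε
    linarith
  have hpart : ∀ N, ∑ n ∈ Finset.range N, ∫ ω, C.stageReward n ω ∂P ≤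
      w 0 C.init + ε / (1 - C.q) + b * C.q ^ N := by
    intro N
    have hN : ∑ n ∈ Finset.range N, ∫ ω, C.stageReward n ω ∂P ≤
        w 0 C.init - (∫ ω, C.acc N (C.hist ω N) * w N (C.hist ω N) ∂P)
          + ε * ∑ n ∈ Finset.range N, C.q ^ n := by
      induction N with
      | zero => simp [hist, C.acc_init]
      | succ N ih =>
        rw [Finset.sum_range_succ, Finset.sum_range_succ]
        linarith [hone N]
    have hgeo : ∑ n ∈ Finset.range N, C.q ^ n ≤ (1 - C.q)⁻¹ := by
      rw [← tsum_geometric_of_lt_one C.q_nonneg C.q_lt_one]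
      exact (summable_geometric_of_lt_one C.q_nonneg C.q_lt_one).sum_le_tsum _
        fun i _ => pow_nonneg C.q_nonneg i
    have hlast : -(∫ ω, C.acc N (C.hist ω N) * w N (C.hist ω N) ∂P) ≤ b * C.q ^ N := by
      rw [← integral_neg]
      refine le_trans ?_ (mul_le_mul_of_nonneg_left (C.integral_acc_le N) hb0)
      rw [← integral_const_mul]
      have hib : Integrable (fun ω => C.acc N (C.hist ω N) * b) P :=
        C.integrable_acc_mul (g := fun _ => b) measurable_const fun _ => le_rfl
      refine integral_mono (hint N).neg (by simpa only [mul_comm] using hib) fun ω => ?_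
      have := mul_le_mul_of_nonneg_left ((neg_le_abs _).trans (hb N (C.hist ω N)))
        (C.acc_hist_nonneg ω N)
      simp only
      linarith
    have := mul_le_mul_of_nonneg_left hgeo hε
    rw [div_eq_mul_inv]
    linarith
  have hlim : Filter.Tendsto (fun N => w 0 C.init + ε / (1 - C.q) + b * C.q ^ N) Filter.atTop
      (nhds (w 0 C.init + ε / (1 - C.q) + b * 0)) :=
    ((tendsto_pow_atTop_nhds_zero_of_lt_one C.q_nonneg C.q_lt_one).const_mul b).const_add _
  rw [mul_zero, add_zero] at hlim
  exact le_of_tendsto_of_tendsto' hsum.tendsto_sum_nat hlim hpart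

/-- The chain with the opposite rewards. -/
def neg : DiscountedChain μ :=
  { C with
    rew := fun n h z => -C.rew n h z
    measurable_rew := fun n => (C.measurable_rew n).neg
    abs_rew_le := fun n h z => (abs_neg _).trans_le (C.abs_rew_le n h z) }

theorem le_integral_tsum {w : ∀ n, C.H n → ℝ} (hw : ∀ n, Measurable (w n)) {b ε : ℝ}
    (hb : ∀ n h, |w n h| ≤ b) (hε : 0 ≤ ε)
    (hstep : ∀ n h, w n h - ε ≤
      ∫ z, (C.rew n h z + C.disc n h z * w (n + 1) (C.next n h z)) ∂μ) :
    w 0 C.init - ε / (1 - C.q) ≤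
      ∫ ω, ∑' n, C.stageReward n ω ∂(Measure.infinitePi fun _ : ℕ => μ) := by
  have hh : ∀ ω n, C.neg.hist ω n = C.hist ω n := by
    intro ω n
    induction n with
    | zero => rfl
    | succ n ih => exact congrArg (fun h => C.next n h (ω n)) ih
  have hs : ∀ n ω, C.neg.stageReward n ω = -C.stageReward n ω := by
    intro n ω
    have : C.neg.stageReward n ω = C.acc n (C.neg.hist ω n) * -C.rew n (C.neg.hist ω n) (ω n) :=
      rfl
    rw [this, hh, mul_neg]
    rfl
  have h := C.neg.integral_tsum_le (w := fun n h => -w n h) (fun n => (hw n).neg) (b := b)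
    (fun n h => (abs_neg _).trans_le (hb n h)) hε fun n h => by
      have e : ∫ z, (C.neg.rew n h z + C.neg.disc n h z * -w (n + 1) (C.neg.next n h z)) ∂μ
          = -∫ z, (C.rew n h z + C.disc n h z * w (n + 1) (C.next n h z)) ∂μ := by
        rw [← integral_neg]
        refine integral_congr_ae (Filter.Eventually.of_forall fun z => ?_)
        change -C.rew n h z + C.disc n h z * -w (n + 1) (C.next n h z) = _
        ring
      rw [e]
      linarith [hstep n h]
  simp only [hs, tsum_neg, integral_neg] at h
  have h' : -∫ ω, ∑' n, C.stageReward n ω ∂(Measure.infinitePi fun _ : ℕ => μ)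
      ≤ -w 0 C.init + ε / (1 - C.q) := h
  linarith

end DiscountedChain


/-! ### Finiteness and bounds -/

instance (NP : ℕ) : Finite (Quotes NP) :=
  Finite.of_injective (fun a : Quotes NP => (a.ask, a.bid)) fun a b h => by
    simp only [Prod.mk.injEq] at h
    exact Quotes.ext h.1 h.2

instance (NP : ℕ) : DiscreteMeasurableSpace (Quotes NP) := ⟨fun _ => trivial⟩

instance (NP : ℕ) : Nonempty (Quotes NP) := ⟨⟨none, none⟩⟩

instance : Finite MMEvent :=
  Finite.of_injective
    (fun e => match e with | .up => (0 : Fin 4) | .down => 1 | .sell => 2 | .buy => 3)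
    fun a b h => by cases a <;> cases b <;> first | rfl | (exact absurd h (by decide))

instance : MeasurableSpace MMEvent := ⊤

instance : DiscreteMeasurableSpace MMEvent := ⟨fun _ => trivial⟩

instance : Nonempty MMEvent := ⟨.up⟩

theorem exists_abs_le_of_finite {α : Type*} [Finite α] (f : α → ℝ) : ∃ B, ∀ x, |f x| ≤ B := by
  obtain ⟨B, hB⟩ := (Set.finite_range fun x => |f x|).bddAbove
  exact ⟨B, fun x => hB ⟨x, rfl⟩⟩

namespace MMModel

variable {M : MMModel}

instance : Nonempty M.State :=
  ⟨(⟨0, by have := M.NP_pos; lia⟩, ⟨0, by simp⟩)⟩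

/-- Every mid-price lies strictly between the extreme grid prices, so these are always admissible
quotes. -/
theorem exists_feasible (s : M.State) : ∃ a, M.Feasible s a := by
  have h1 : M.mid s.1 < M.quote (Fin.last M.NP) := by
    have hk : ((s.1 : ℕ) + 1 : ℝ) < 2 * M.NP := by
      have := s.1.2
      have h : (s.1 : ℕ) + 1 < 2 * M.NP := by lia
      exact_mod_cast h
    have := M.tick_pos
    simp only [mid, quote, Fin.val_last]
    nlinarith
  have h2 : M.quote 0 < M.mid s.1 := by
    have := M.tick_pos
    simp only [mid, quote, Fin.val_zero, Nat.cast_zero, zero_mul]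
    positivity
  refine ⟨⟨if (s.2 : ℤ) = -(M.NY : ℤ) then none else some (Fin.last M.NP),
    if (s.2 : ℤ) = (M.NY : ℤ) then none else some 0⟩, ?_, ?_⟩
  · by_cases h : (s.2 : ℤ) = -(M.NY : ℤ)
    · simp [h]
    · simpa [h] using h1
  · by_cases h : (s.2 : ℤ) = (M.NY : ℤ)
    · simp [h]
    · simpa [h] using h2

instance : Nonempty M.StatPolicy := by
  choose a ha using exists_feasible (M := M)
  exact ⟨⟨a, ha⟩⟩

instance : Finite M.StatPolicy :=
  Finite.of_injective StatPolicy.act fun _ _ h => StatPolicy.ext h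

theorem fillRate_nonneg (k : M.PriceIdx) (q : Option (Fin (M.NP + 1))) : 0 ≤ M.fillRate k q := by
  cases q with
  | none => exact le_rfl
  | some p => exact mul_nonneg M.alpha_pos.le (Real.exp_pos _).le

theorem upRate_nonneg (hrate : M.RateAssumption) (k : M.PriceIdx) (a : Quotes M.NP) :
    0 ≤ M.upRate k a := by
  obtain ⟨C, -, hC⟩ := hrate
  unfold upRate
  split_ifs with h
  · exact (hC _ _ _ (Or.inl rfl)).1.le
  · exact le_rfl

theorem downRate_nonneg (hrate : M.RateAssumption) (k : M.PriceIdx) (a : Quotes M.NP) :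
    0 ≤ M.downRate k a := by
  obtain ⟨C, -, hC⟩ := hrate
  unfold downRate
  split_ifs with h
  · exact (hC _ _ _ (Or.inr (Nat.sub_add_cancel h))).1.le
  · exact le_rfl

theorem eventRate_nonneg (hrate : M.RateAssumption) (s : M.State) (a : Quotes M.NP)
    (e : MMEvent) : 0 ≤ M.eventRate s a e := by
  cases e
  · exact upRate_nonneg hrate _ _
  · exact downRate_nonneg hrate _ _
  · exact fillRate_nonneg _ _
  · exact fillRate_nonneg _ _

/-- As N_Y ≥ 1, the inventory cannot be at both ends at once, so at least one order is present and
has a positive fill rate. This matters when there is a single mid-price and no price move is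
possible. -/
theorem totalRate_pos (hrate : M.RateAssumption) {s : M.State} {a : Quotes M.NP}
    (h : M.Feasible s a) : 0 < M.totalRate s a := by
  have h1 := eventRate_nonneg hrate s a .up
  have h2 := eventRate_nonneg hrate s a .down
  have h3 := eventRate_nonneg hrate s a .sell
  have h4 := eventRate_nonneg hrate s a .buy
  have hpos : ∀ k p, 0 < M.fillRate k (some p) := fun k p =>
    mul_pos M.alpha_pos (Real.exp_pos _)
  unfold totalRate
  by_cases hy : (s.2 : ℤ) = -(M.NY : ℤ)
  · have hy' : (s.2 : ℤ) ≠ (M.NY : ℤ) := by have := M.NY_pos; lia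
    obtain ⟨p, hp, -⟩ := (if_neg hy').mp h.2
    have : 0 < M.eventRate s a .buy := by simp only [eventRate, hp]; exact hpos _ _
    linarith
  · obtain ⟨p, hp, -⟩ := (if_neg hy).mp h.1
    have : 0 < M.eventRate s a .sell := by simp only [eventRate, hp]; exact hpos _ _
    linarith

theorem exists_totalRate_bounds (hrate : M.RateAssumption) :
    ∃ l L : ℝ, 0 < l ∧ ∀ s a, M.Feasible s a → l ≤ M.totalRate s a ∧ M.totalRate s a ≤ L := by
  classical
  obtain ⟨x, hx⟩ := Finite.exists_min fun p : M.State × Quotes M.NP =>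
    -- Infeasible pairs receive the harmless value 1, so that the minimum over the finite set is
    -- positive.
    if M.Feasible p.1 p.2 then M.totalRate p.1 p.2 else 1
  obtain ⟨L, hL⟩ := exists_abs_le_of_finite fun p : M.State × Quotes M.NP => M.totalRate p.1 p.2
  refine ⟨if M.Feasible x.1 x.2 then M.totalRate x.1 x.2 else 1, L, ?_,
    fun s a h => ⟨?_, (le_abs_self _).trans (hL (s, a))⟩⟩
  · split_ifs with h
    · exact totalRate_pos hrate h
    · exact zero_lt_one
  · simpa [h] using hx (s, a)

/-! ### The kind of a jump -/

/-- The generator-type sum `∑ₑ rate(e) g(e)` over the possible jumps. -/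
def eventSum (M : MMModel) (s : M.State) (a : Quotes M.NP) (g : MMEvent → ℝ) : ℝ :=
  M.eventRate s a .up * g .up + M.eventRate s a .down * g .down
    + M.eventRate s a .sell * g .sell + M.eventRate s a .buy * g .buy

end MMModel

theorem integral_unitInterval_ite_lt {p : ℝ} (h0 : 0 ≤ p) (h1 : p ≤ 1) :
    ∫ v : I, (if (v : ℝ) < p then (1 : ℝ) else 0) = p := by
  have h : (fun v : I => if (v : ℝ) < p then (1 : ℝ) else 0) =
      (Set.Iio (⟨p, h0, h1⟩ : I)).indicator 1 := by
    ext v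
    simp [Set.indicator_apply, ← Subtype.coe_lt_coe]
  rw [h, integral_indicator_one measurableSet_Iio, measureReal_def, unitInterval.volume_Iio,
    ENNReal.toReal_ofReal h0]

theorem measurable_ite_unitInterval_lt (p x y : ℝ) :
    Measurable fun v : I => if (v : ℝ) < p then x else y :=
  Measurable.ite (measurableSet_lt measurable_subtype_coe measurable_const) measurable_const
    measurable_const

theorem integrable_ite_unitInterval_lt (p x y : ℝ) :
    Integrable fun v : I => if (v : ℝ) < p then x else y :=
  Integrable.of_bound (C := max |x| |y|) (measurable_ite_unitInterval_lt p x y).aestronglyMeasurable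
    (Filter.Eventually.of_forall fun v => by
      split_ifs
      · exact le_max_left _ _
      · exact le_max_right _ _)

namespace MMModel

variable {M : MMModel}

theorem integral_drawEvent (hrate : M.RateAssumption) {s : M.State} {a : Quotes M.NP}
    (h : M.Feasible s a) (g : MMEvent → ℝ) :
    ∫ v : I, g (M.drawEvent s a v) = M.eventSum s a g / M.totalRate s a := by
  have ht := totalRate_pos hrate h
  have h1 := eventRate_nonneg hrate s a .up
  have h2 := eventRate_nonneg hrate s a .down
  have h3 := eventRate_nonneg hrate s a .sell
  have h4 := eventRate_nonneg hrate s a .buy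
  have htot : M.totalRate s a = M.eventRate s a .up + M.eventRate s a .down
    + M.eventRate s a .sell + M.eventRate s a .buy := rfl
  unfold eventSum drawEvent
  generalize M.totalRate s a = R at *
  generalize M.eventRate s a .up = x1 at *
  generalize M.eventRate s a .down = x2 at *
  generalize M.eventRate s a .sell = x3 at *
  generalize M.eventRate s a .buy = x4 at *
  have hp : ∀ p, 0 ≤ p → p ≤ R → ∫ v : I, (if (v : ℝ) < p / R then (1 : ℝ) else 0) = p / R :=
    fun p h0 h1 => integral_unitInterval_ite_lt (by positivity) ((div_le_one ht).2 h1)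
  have hi : ∀ p, Integrable fun v : I => if (v : ℝ) < p / R then (1 : ℝ) else 0 :=
    fun p => integrable_ite_unitInterval_lt _ _ _
  -- Summation by parts: a step function with three thresholds is a constant plus a combination of
  -- three indicators of initial intervals.
  have e : (fun v : I => g (if (v : ℝ) * R < x1 then .up
      else if (v : ℝ) * R < x1 + x2 then .down
      else if (v : ℝ) * R < x1 + x2 + x3 then .sell else .buy)) = fun v : I =>
      (g .up - g .down) * (if (v : ℝ) < x1 / R then (1 : ℝ) else 0)
      + (g .down - g .sell) * (if (v : ℝ) < (x1 + x2) / R then (1 : ℝ) else 0)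
      + (g .sell - g .buy) * (if (v : ℝ) < (x1 + x2 + x3) / R then (1 : ℝ) else 0)
      + g .buy := by
    ext v
    simp only [lt_div_iff₀ ht]
    split_ifs <;> first | (exfalso; linarith) | ring
  rw [e, integral_add, integral_add, integral_add, integral_const_mul, integral_const_mul,
    integral_const_mul, hp _ h1 (by linarith), hp _ (by linarith) (by linarith),
    hp _ (by linarith) (by linarith)]
  · simp only [integral_const, probReal_univ, one_smul]
    rw [htot] at ht ⊢
    field_simp
    ring
  · exact (hi _).const_mul _
  · exact (hi _).const_mul _
  · exact ((hi _).const_mul _).add ((hi _).const_mul _)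
  · exact (hi _).const_mul _
  · exact (((hi _).const_mul _).add ((hi _).const_mul _)).add ((hi _).const_mul _)
  · exact integrable_const _

theorem measurable_drawEvent :
    Measurable fun p : (M.State × Quotes M.NP) × I => M.drawEvent p.1.1 p.1.2 p.2 := by
  refine measurable_from_prod_countable_right fun p => ?_
  have hm : ∀ x, MeasurableSet {v : I | (v : ℝ) * M.totalRate p.1 p.2 < x} := fun x =>
    measurableSet_lt (measurable_subtype_coe.mul_const _) measurable_const
  change Measurable fun v : I => M.drawEvent p.1 p.2 v
  unfold drawEvent
  refine Measurable.ite (hm _) measurable_const ?_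
  refine Measurable.ite (hm _) measurable_const ?_
  exact Measurable.ite (hm _) measurable_const measurable_const

end MMModel


namespace MMModel

variable {M : MMModel}

/-! ### One epoch of the continuous-time problem -/

/-- The distribution of the two uniform variables that drive one jump. -/
abbrev epochMeasure : Measure (I × I) := (volume : Measure I).prod (volume : Measure I)

theorem exp_neg_gamma_mul_le_one {t : ℝ} (ht : 0 ≤ t) : Real.exp (-M.gamma * t) ≤ 1 :=
  Real.exp_le_one_iff.2 (by have := M.gamma_pos; nlinarith)

/-- The reward of an epoch that starts in the state `s` at time `0` and in which the quotes
`a r` are in force at time `r`. -/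
def epochReward (M : MMModel) (s : M.State) (a : ℝ → Quotes M.NP) (z : I × I) : ℝ :=
  Real.exp (-M.gamma * hazardTime (fun r => M.totalRate s (a r)) z.1) *
      M.eventReward s (a (hazardTime (fun r => M.totalRate s (a r)) z.1))
        (M.drawEvent s (a (hazardTime (fun r => M.totalRate s (a r)) z.1)) z.2)
    - M.penalty s *
      ((1 - Real.exp (-M.gamma * hazardTime (fun r => M.totalRate s (a r)) z.1)) / M.gamma)

/-- The state after such an epoch. -/
def epochState (M : MMModel) (s : M.State) (a : ℝ → Quotes M.NP) (z : I × I) : M.State :=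
  M.afterEvent s (M.drawEvent s (a (hazardTime (fun r => M.totalRate s (a r)) z.1)) z.2)

section Epoch

variable {s : M.State} {a : ℝ → Quotes M.NP} {l L : ℝ}

/-- The discounted total of the epoch reward and of a terminal payoff `W` at its end. -/
theorem integral_epoch (hrate : M.RateAssumption) (ha : Measurable a)
    (hfeas : ∀ r, M.Feasible s (a r)) (h0 : 0 < l) (hl : ∀ r, l ≤ M.totalRate s (a r))
    (hL : ∀ r, M.totalRate s (a r) ≤ L) (W : M.State → ℝ) :
    ∫ z, (M.epochReward s a z
        + Real.exp (-M.gamma * hazardTime (fun r => M.totalRate s (a r)) z.1)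
          * W (M.epochState s a z)) ∂epochMeasure =
      ∫ u : I, (Real.exp (-M.gamma * hazardTime (fun r => M.totalRate s (a r)) u) *
        (M.eventSum s (a (hazardTime (fun r => M.totalRate s (a r)) u))
            (fun e => M.eventReward s (a (hazardTime (fun r => M.totalRate s (a r)) u)) e
              + W (M.afterEvent s e))
          / M.totalRate s (a (hazardTime (fun r => M.totalRate s (a r)) u))
          + M.penalty s / M.gamma) - M.penalty s / M.gamma) := by
  have hρ : Measurable fun r => M.totalRate s (a r) :=
    (measurable_of_countable fun b => M.totalRate s b).comp ha
  have hτ : Measurable fun u : I => hazardTime (fun r => M.totalRate s (a r)) u :=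
    measurable_hazardTime_of_rate hρ h0 hl hL
  obtain ⟨B, hB⟩ := exists_abs_le_of_finite fun p : Quotes M.NP × MMEvent =>
    M.eventReward s p.1 p.2 + W (M.afterEvent s p.2)
  set τ : I → ℝ := fun u => hazardTime (fun r => M.totalRate s (a r)) u with hτdef
  have hτ0 : ∀ u, 0 ≤ τ u := fun u => hazardTime_nonneg _ _
  -- The accumulated penalty -p(1 - e^{-γτ})/γ is split as e^{-γτ} p/γ - p/γ, so that all random
  -- terms share the factor e^{-γτ}.
  let f : I × I → ℝ := fun z => Real.exp (-M.gamma * τ z.1) *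
    (M.eventReward s (a (τ z.1)) (M.drawEvent s (a (τ z.1)) z.2)
      + W (M.afterEvent s (M.drawEvent s (a (τ z.1)) z.2)) + M.penalty s / M.gamma)
      - M.penalty s / M.gamma
  have hdraw : Measurable fun z : I × I => M.drawEvent s (a (τ z.1)) z.2 :=
    (measurable_drawEvent (M := M)).comp ((measurable_const.prodMk
      (ha.comp (hτ.comp measurable_fst))).prodMk measurable_snd)
  have hfm : Measurable f := by
    have h1 : Measurable fun z : I × I =>
        M.eventReward s (a (τ z.1)) (M.drawEvent s (a (τ z.1)) z.2)
          + W (M.afterEvent s (M.drawEvent s (a (τ z.1)) z.2)) :=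
      (measurable_of_countable fun p : Quotes M.NP × MMEvent =>
        M.eventReward s p.1 p.2 + W (M.afterEvent s p.2)).comp
        ((ha.comp (hτ.comp measurable_fst)).prodMk hdraw)
    have h2 : Measurable fun z : I × I => Real.exp (-M.gamma * τ z.1) :=
      ((hτ.comp measurable_fst).const_mul _).exp
    exact (h2.mul (h1.add_const _)).sub_const _
  have hfi : Integrable f epochMeasure := by
    refine Integrable.of_bound (C := (B + |M.penalty s / M.gamma|) + |M.penalty s / M.gamma|)
      hfm.aestronglyMeasurable (Filter.Eventually.of_forall fun z => ?_)
    refine (norm_sub_le _ _).trans (add_le_add_left ?_ _)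
    rw [norm_mul, Real.norm_of_nonneg (Real.exp_pos _).le]
    refine (mul_le_mul (exp_neg_gamma_mul_le_one (hτ0 z.1)) ((norm_add_le _ _).trans
      (add_le_add_left (hB (a (τ z.1), M.drawEvent s (a (τ z.1)) z.2)) _)) (norm_nonneg _)
      zero_le_one).trans_eq (one_mul _)
  have e1 : ∀ z, M.epochReward s a z + Real.exp (-M.gamma * τ z.1) * W (M.epochState s a z)
      = f z := fun z => by
    simp only [epochReward, epochState, f, hτdef]
    ring
  calc _ = ∫ z, f z ∂epochMeasure := integral_congr_ae (Filter.Eventually.of_forall e1)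
    _ = ∫ u : I, ∫ v : I, f (u, v) := integral_prod f hfi
    _ = _ := by
      refine integral_congr_ae (Filter.Eventually.of_forall fun u => ?_)
      have hgi : Integrable fun v : I => M.eventReward s (a (τ u)) (M.drawEvent s (a (τ u)) v)
          + W (M.afterEvent s (M.drawEvent s (a (τ u)) v)) :=
        Integrable.of_bound (C := B) ((measurable_of_countable fun e : MMEvent =>
          M.eventReward s (a (τ u)) e + W (M.afterEvent s e)).comp
          (hdraw.comp (measurable_const (a := u) |>.prodMk measurable_id))).aestronglyMeasurable
          (Filter.Eventually.of_forall fun v => hB (a (τ u), M.drawEvent s (a (τ u)) v))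
      have hg2 := integral_drawEvent hrate (hfeas (τ u))
        (fun e => M.eventReward s (a (τ u)) e + W (M.afterEvent s e))
      simp only [f]
      have hgi' : Integrable fun v : I => Real.exp (-M.gamma * τ u) *
          (M.eventReward s (a (τ u)) (M.drawEvent s (a (τ u)) v)
            + W (M.afterEvent s (M.drawEvent s (a (τ u)) v)) + M.penalty s / M.gamma) :=
        (hgi.add (integrable_const _)).const_mul _
      rw [integral_sub hgi' (integrable_const _),
        integral_const_mul, integral_add hgi (integrable_const _), hg2]
      simp [hτdef]

/-- This is the integrand of `integral_epoch` when the Bellman relation holds with equality at every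
time and w = W(s). It is the resolvent identity multiplied by w + p/γ, whatever the quotes are. -/
theorem epoch_identity (ha : Measurable a) (h0 : 0 < l)
    (hl : ∀ r, l ≤ M.totalRate s (a r)) (hL : ∀ r, M.totalRate s (a r) ≤ L) (w : ℝ) :
    Integrable (fun u : I => Real.exp (-M.gamma * hazardTime (fun r => M.totalRate s (a r)) u) *
        (w + (M.gamma * w + M.penalty s)
          / M.totalRate s (a (hazardTime (fun r => M.totalRate s (a r)) u))
          + M.penalty s / M.gamma) - M.penalty s / M.gamma) ∧
    ∫ u : I, (Real.exp (-M.gamma * hazardTime (fun r => M.totalRate s (a r)) u) *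
        (w + (M.gamma * w + M.penalty s)
          / M.totalRate s (a (hazardTime (fun r => M.totalRate s (a r)) u))
          + M.penalty s / M.gamma) - M.penalty s / M.gamma) = w := by
  have hρ : Measurable fun r => M.totalRate s (a r) :=
    (measurable_of_countable fun b => M.totalRate s b).comp ha
  have h := integral_exp_hazardTime hρ h0 hl hL M.gamma_pos
  have hγ := M.gamma_pos
  set τ : I → ℝ := fun u => hazardTime (fun r => M.totalRate s (a r)) u with hτdef
  have e : ∀ u : I, Real.exp (-M.gamma * τ u) *
      (w + (M.gamma * w + M.penalty s) / M.totalRate s (a (τ u)) + M.penalty s / M.gamma)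
        - M.penalty s / M.gamma =
      (w + M.penalty s / M.gamma) *
        (Real.exp (-M.gamma * τ u) * (1 + M.gamma / M.totalRate s (a (τ u))))
        - M.penalty s / M.gamma := by
    intro u
    have : M.totalRate s (a (τ u)) ≠ 0 := (h0.trans_le (hl _)).ne'
    field_simp
    ring
  have hi : Integrable fun u : I =>
      Real.exp (-M.gamma * τ u) * (1 + M.gamma / M.totalRate s (a (τ u))) := by
    -- Integrability comes for free: the integral is known to be 1, while that of a nonintegrable
    -- function is 0 by convention.
    by_contra hn
    rw [integral_undef hn] at h
    exact zero_ne_one h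
  simp only [hτdef] at e hi ⊢
  simp only [e]
  refine ⟨(hi.const_mul _).sub (integrable_const _), ?_⟩
  rw [integral_sub (hi.const_mul _) (integrable_const _), integral_const_mul, h]
  simp

theorem integrable_epoch_sum (ha : Measurable a) (h0 : 0 < l)
    (hl : ∀ r, l ≤ M.totalRate s (a r)) (hL : ∀ r, M.totalRate s (a r) ≤ L) (W : M.State → ℝ) :
    Integrable fun u : I =>
      Real.exp (-M.gamma * hazardTime (fun r => M.totalRate s (a r)) u) *
        (M.eventSum s (a (hazardTime (fun r => M.totalRate s (a r)) u))
            (fun e => M.eventReward s (a (hazardTime (fun r => M.totalRate s (a r)) u)) e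
              + W (M.afterEvent s e))
          / M.totalRate s (a (hazardTime (fun r => M.totalRate s (a r)) u))
          + M.penalty s / M.gamma) - M.penalty s / M.gamma := by
  have hρ : Measurable fun r => M.totalRate s (a r) :=
    (measurable_of_countable fun b => M.totalRate s b).comp ha
  have hτ : Measurable fun u : I => hazardTime (fun r => M.totalRate s (a r)) u :=
    measurable_hazardTime_of_rate hρ h0 hl hL
  let G : Quotes M.NP → ℝ := fun b =>
    M.eventSum s b (fun e => M.eventReward s b e + W (M.afterEvent s e)) / M.totalRate s b
          + M.penalty s / M.gamma
  obtain ⟨B, hB⟩ := exists_abs_le_of_finite G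
  refine Integrable.sub ?_ (integrable_const _)
  refine Integrable.of_bound (C := B) ((hτ.const_mul _).exp.mul
    ((measurable_of_countable G).comp (ha.comp hτ))).aestronglyMeasurable
    (Filter.Eventually.of_forall fun u => ?_)
  rw [norm_mul, Real.norm_of_nonneg (Real.exp_pos _).le]
  exact (mul_le_mul (exp_neg_gamma_mul_le_one (hazardTime_nonneg _ _)) (hB _) (abs_nonneg _)
      zero_le_one).trans_eq (one_mul _)

/-- A supersolution of the Bellman equation dominates the payoff of an epoch. -/
theorem integral_epoch_le (hrate : M.RateAssumption) (ha : Measurable a)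
    (hfeas : ∀ r, M.Feasible s (a r)) (h0 : 0 < l) (hl : ∀ r, l ≤ M.totalRate s (a r))
    (hL : ∀ r, M.totalRate s (a r) ≤ L) {W : M.State → ℝ}
    (hW : ∀ r, M.eventSum s (a r) (fun e => M.eventReward s (a r) e + W (M.afterEvent s e))
      ≤ (M.gamma + M.totalRate s (a r)) * W s + M.penalty s) :
    ∫ z, (M.epochReward s a z
        + Real.exp (-M.gamma * hazardTime (fun r => M.totalRate s (a r)) z.1)
          * W (M.epochState s a z)) ∂epochMeasure ≤ W s := by
  obtain ⟨hi, he⟩ := epoch_identity ha h0 hl hL (W s)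
  rw [integral_epoch hrate ha hfeas h0 hl hL W]
  refine (integral_mono (integrable_epoch_sum ha h0 hl hL W) hi fun u => ?_).trans_eq he
  refine sub_le_sub_right (mul_le_mul_of_nonneg_left (add_le_add_left ?_ _)
    (Real.exp_pos _).le) _
  have hpos := h0.trans_le (hl (hazardTime (fun r => M.totalRate s (a r)) u))
  rw [div_le_iff₀ hpos, add_mul, div_mul_cancel₀ _ hpos.ne']
  linarith [hW (hazardTime (fun r => M.totalRate s (a r)) u)]

/-- The payoff of an epoch dominates a subsolution of the Bellman equation. -/
theorem le_integral_epoch (hrate : M.RateAssumption) (ha : Measurable a)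
    (hfeas : ∀ r, M.Feasible s (a r)) (h0 : 0 < l) (hl : ∀ r, l ≤ M.totalRate s (a r))
    (hL : ∀ r, M.totalRate s (a r) ≤ L) {W : M.State → ℝ}
    (hW : ∀ r, (M.gamma + M.totalRate s (a r)) * W s + M.penalty s
      ≤ M.eventSum s (a r) (fun e => M.eventReward s (a r) e + W (M.afterEvent s e))) :
    W s ≤ ∫ z, (M.epochReward s a z
        + Real.exp (-M.gamma * hazardTime (fun r => M.totalRate s (a r)) z.1)
          * W (M.epochState s a z)) ∂epochMeasure := by
  obtain ⟨hi, he⟩ := epoch_identity ha h0 hl hL (W s)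
  rw [integral_epoch hrate ha hfeas h0 hl hL W]
  refine he.symm.trans_le (integral_mono hi (integrable_epoch_sum ha h0 hl hL W) fun u => ?_)
  refine sub_le_sub_right (mul_le_mul_of_nonneg_left (add_le_add_left ?_ _)
    (Real.exp_pos _).le) _
  have hpos := h0.trans_le (hl (hazardTime (fun r => M.totalRate s (a r)) u))
  rw [le_div_iff₀ hpos, add_mul, div_mul_cancel₀ _ hpos.ne']
  linarith [hW (hazardTime (fun r => M.totalRate s (a r)) u)]

/-- Jumps come no faster than at rate `L`, and L/(γ + L) is the mean discount up to an exponential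
time of rate `L`. It follows from the resolvent identity, since 1 + γ/ρ ≥ 1 + γ/L. -/
theorem integral_exp_epoch_le (ha : Measurable a) (h0 : 0 < l)
    (hl : ∀ r, l ≤ M.totalRate s (a r)) (hL : ∀ r, M.totalRate s (a r) ≤ L) :
    ∫ z : I × I, Real.exp (-M.gamma * hazardTime (fun r => M.totalRate s (a r)) z.1)
      ∂epochMeasure ≤ L / (M.gamma + L) := by
  have hρ : Measurable fun r => M.totalRate s (a r) :=
    (measurable_of_countable fun b => M.totalRate s b).comp ha
  have h := integral_exp_hazardTime hρ h0 hl hL M.gamma_pos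
  have hτ : Measurable fun u : I => hazardTime (fun r => M.totalRate s (a r)) u :=
    measurable_hazardTime_of_rate hρ h0 hl hL
  have hLpos : 0 < L := h0.trans_le ((hl 0).trans (hL 0))
  have hγ := M.gamma_pos
  have hi : Integrable fun u : I => Real.exp
      (-M.gamma * hazardTime (fun r => M.totalRate s (a r)) u) *
      (1 + M.gamma / M.totalRate s (a (hazardTime (fun r => M.totalRate s (a r)) u))) := by
    by_contra hn
    rw [integral_undef hn] at h
    exact zero_ne_one h
  have hi2 : Integrable fun u : I => Real.exp
      (-M.gamma * hazardTime (fun r => M.totalRate s (a r)) u) :=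
    Integrable.of_bound (C := 1) (hτ.const_mul _).exp.aestronglyMeasurable
      (Filter.Eventually.of_forall fun u => by
        rw [Real.norm_of_nonneg (Real.exp_pos _).le]
        exact exp_neg_gamma_mul_le_one (hazardTime_nonneg _ _))
  rw [integral_fun_fst (μ := (volume : Measure I)) (ν := (volume : Measure I))
    (fun u : I => Real.exp (-M.gamma * hazardTime (fun r => M.totalRate s (a r)) u))]
  simp only [probReal_univ, one_smul]
  have h2 := integral_mono hi2 (hi.const_mul (L / (M.gamma + L))) fun u => by
    have hpos := h0.trans_le (hl (hazardTime (fun r => M.totalRate s (a r)) u))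
    have hle := hL (hazardTime (fun r => M.totalRate s (a r)) u)
    have h3 : M.gamma / L ≤
        M.gamma / M.totalRate s (a (hazardTime (fun r => M.totalRate s (a r)) u)) :=
      div_le_div_of_nonneg_left hγ.le hpos hle
    have h4 : 1 = L / (M.gamma + L) * (1 + M.gamma / L) := by field_simp; ring
    have h5 : 1 ≤ L / (M.gamma + L) *
        (1 + M.gamma / M.totalRate s (a (hazardTime (fun r => M.totalRate s (a r)) u))) := by
      conv_lhs => rw [h4]
      gcongr
    have h6 := Real.exp_pos (-M.gamma * hazardTime (fun r => M.totalRate s (a r)) u)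
    simp only
    nlinarith
  rw [integral_const_mul, h, mul_one] at h2
  exact h2

end Epoch

end MMModel


theorem measurable_fin_snoc {β : Type*} [MeasurableSpace β] (n : ℕ) :
    Measurable fun p : (Fin n → β) × β => (Fin.snoc (α := fun _ => β) p.1 p.2 : Fin (n + 1) → β) := by
  refine measurable_pi_lambda _ fun i => ?_
  refine Fin.lastCases ?_ (fun j => ?_) i
  · simpa only [Fin.snoc_last] using measurable_snd
  · simpa only [Fin.snoc_castSucc, Function.comp_def] using
      (measurable_pi_apply j).comp (measurable_fst (β := β))

namespace MMModel

variable {M : MMModel}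

/-! ### The continuous-time problem as a discounted chain -/

theorem measurable_act_path (π : M.ContPolicy) (n : ℕ) (h : Fin (n + 1) → ℝ × M.State) :
    Measurable (π.act n h) :=
  (π.measurable_act n).comp (measurable_const.prodMk measurable_id)

theorem measurable_last_state (n : ℕ) :
    Measurable fun h : Fin (n + 1) → ℝ × M.State => (h (Fin.last n)).2 :=
  measurable_snd.comp (measurable_pi_apply (Fin.last n))

theorem integral_exp_penalty (p T r : ℝ) :
    ∫ t in T..(T + r), Real.exp (-M.gamma * t) * p =
      Real.exp (-M.gamma * T) * (p * ((1 - Real.exp (-M.gamma * r)) / M.gamma)) := by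
  have hγ := M.gamma_pos.ne'
  rw [intervalIntegral.integral_mul_const,
    intervalIntegral.integral_comp_mul_left (fun x => Real.exp x) (neg_ne_zero.2 hγ), integral_exp,
    mul_add, Real.exp_add, smul_eq_mul]
  field_simp
  ring

section Bounds

variable {l L : ℝ}

theorem measurable_holdTime (h0 : 0 < l)
    (hb : ∀ s a, M.Feasible s a → l ≤ M.totalRate s a ∧ M.totalRate s a ≤ L) (π : M.ContPolicy) (n : ℕ) :
    Measurable fun p : (Fin (n + 1) → ℝ × M.State) × (I × I) => M.holdTime π n p.1 p.2.1 := by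
  have hm : Measurable fun p : (Fin (n + 1) → ℝ × M.State) × ℝ =>
      M.totalRate (p.1 (Fin.last n)).2 (π.act n p.1 p.2) :=
    (measurable_of_countable fun x : M.State × Quotes M.NP => M.totalRate x.1 x.2).comp
      (((measurable_last_state n).comp measurable_fst).prodMk (π.measurable_act n))
  have key : Measurable fun p : (Fin (n + 1) → ℝ × M.State) × I => M.holdTime π n p.1 p.2 :=
    measurable_hazardTime (ρ := fun (h : Fin (n + 1) → ℝ × M.State) r =>
      M.totalRate (h (Fin.last n)).2 (π.act n h r)) hm h0
      (fun h r => (hb _ _ (π.feasible n h r)).1) (fun h r => (hb _ _ (π.feasible n h r)).2)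
  have hp : Measurable fun p : (Fin (n + 1) → ℝ × M.State) × (I × I) => (p.1, p.2.1) :=
    measurable_fst.prodMk (measurable_fst.comp measurable_snd)
  simpa only [Function.comp_def] using key.comp hp

theorem measurable_jump (h0 : 0 < l)
    (hb : ∀ s a, M.Feasible s a → l ≤ M.totalRate s a ∧ M.totalRate s a ≤ L) (π : M.ContPolicy) (n : ℕ) :
    Measurable fun p : (Fin (n + 1) → ℝ × M.State) × (I × I) =>
      ((p.1 (Fin.last n)).2, π.act n p.1 (M.holdTime π n p.1 p.2.1), M.nextEvent π n p.1 p.2) := by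
  have ha : Measurable fun p : (Fin (n + 1) → ℝ × M.State) × (I × I) =>
      π.act n p.1 (M.holdTime π n p.1 p.2.1) :=
    (π.measurable_act n).comp (measurable_fst.prodMk (measurable_holdTime h0 hb π n))
  have hs : Measurable fun p : (Fin (n + 1) → ℝ × M.State) × (I × I) => (p.1 (Fin.last n)).2 :=
    (measurable_last_state n).comp measurable_fst
  refine hs.prodMk (ha.prodMk ?_)
  exact (measurable_drawEvent (M := M)).comp
    ((hs.prodMk ha).prodMk (measurable_snd.comp measurable_snd))

variable (h0 : 0 < l) (hb : ∀ s a, M.Feasible s a → l ≤ M.totalRate s a ∧ M.totalRate s a ≤ L)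

/-- The history of the jumps under the policy `π`, as a discounted chain. -/
def contChain {B : ℝ} (hB : ∀ x : M.State × Quotes M.NP × MMEvent,
    |M.eventReward x.1 x.2.1 x.2.2| + |M.penalty x.1 / M.gamma| ≤ B)
    (π : M.ContPolicy) (s : M.State) : DiscountedChain epochMeasure where
  H n := Fin (n + 1) → ℝ × M.State
  next n h z := Fin.snoc (α := fun _ => ℝ × M.State) h
      ((h (Fin.last n)).1 + M.holdTime π n h z.1,
        M.afterEvent (h (Fin.last n)).2 (M.nextEvent π n h z))
  init := fun _ => (0, s)
  acc n h := Real.exp (-M.gamma * (h (Fin.last n)).1)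
  disc n h z := Real.exp (-M.gamma * M.holdTime π n h z.1)
  -- Reward and discount are measured from the start of the epoch; the factor e^{-γTₙ} is carried by
  -- `acc`.
  rew n h z := M.epochReward (h (Fin.last n)).2 (π.act n h) z
  q := L / (M.gamma + L)
  K := B
  measurable_next n := by
    refine (measurable_fin_snoc (n + 1)).comp (measurable_fst.prodMk (Measurable.prodMk ?_ ?_))
    · exact ((measurable_fst.comp (measurable_pi_apply (Fin.last n))).comp measurable_fst).add
        (measurable_holdTime h0 hb π n)
    · exact (measurable_of_countable fun x : M.State × Quotes M.NP × MMEvent =>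
        M.afterEvent x.1 x.2.2).comp (measurable_jump h0 hb π n)
  measurable_acc n := ((measurable_fst.comp (measurable_pi_apply (Fin.last n))).const_mul _).exp
  measurable_disc n := ((measurable_holdTime h0 hb π n).const_mul _).exp
  measurable_rew n := by
    have h1 := (measurable_of_countable fun x : M.State × Quotes M.NP × MMEvent =>
      M.eventReward x.1 x.2.1 x.2.2).comp (measurable_jump h0 hb π n)
    have h2 := ((measurable_holdTime h0 hb π n).const_mul (-M.gamma)).exp
    have h3 : Measurable fun p : (Fin (n + 1) → ℝ × M.State) × (I × I) =>
        M.penalty (p.1 (Fin.last n)).2 :=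
      (measurable_of_countable M.penalty).comp ((measurable_last_state n).comp measurable_fst)
    exact (h2.mul h1).sub (h3.mul ((measurable_const.sub h2).div_const _))
  acc_init := by simp
  acc_next n h z := by
    rw [Fin.snoc_last, ← Real.exp_add]
    congr 1
    ring
  disc_nonneg n h z := (Real.exp_pos _).le
  disc_le_one n h z := exp_neg_gamma_mul_le_one (hazardTime_nonneg _ _)
  integral_disc_le n h := integral_exp_epoch_le (measurable_act_path π n h) h0
    (fun r => (hb _ _ (π.feasible n h r)).1) (fun r => (hb _ _ (π.feasible n h r)).2)
  q_lt_one := by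
    have h1 := hb _ _ (π.feasible 0 (fun _ => (0, s)) 0)
    have h2 := M.gamma_pos
    rw [div_lt_one (by linarith)]
    linarith
  abs_rew_le n h z := by
    have hγ := M.gamma_pos
    refine (abs_sub _ _).trans ((add_le_add ?_ ?_).trans (hB ((h (Fin.last n)).2,
      π.act n h (M.holdTime π n h z.1), M.nextEvent π n h z)))
    · rw [abs_mul, abs_of_pos (Real.exp_pos _)]
      exact mul_le_of_le_one_left (abs_nonneg _)
        (exp_neg_gamma_mul_le_one (hazardTime_nonneg _ _))
    · rw [mul_div_assoc', mul_comm, mul_div_assoc, abs_mul]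
      refine mul_le_of_le_one_left (abs_nonneg _) ?_
      have := exp_neg_gamma_mul_le_one (M := M) (hazardTime_nonneg
        (fun r => M.totalRate (h (Fin.last n)).2 (π.act n h r)) z.1)
      rw [abs_of_nonneg (by linarith)]
      have := Real.exp_pos (-M.gamma * hazardTime
        (fun r => M.totalRate (h (Fin.last n)).2 (π.act n h r)) z.1)
      linarith

variable {B : ℝ} (hB : ∀ x : M.State × Quotes M.NP × MMEvent,
    |M.eventReward x.1 x.2.1 x.2.2| + |M.penalty x.1 / M.gamma| ≤ B)

theorem contHist_eq (π : M.ContPolicy) (s : M.State) (ω : ℕ → I × I) (n : ℕ) :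
    M.contHist π s ω n = (contChain h0 hb hB π s).hist ω n := by
  induction n with
  | zero => rfl
  | succ n ih =>
    change _ = (contChain h0 hb hB π s).next n ((contChain h0 hb hB π s).hist ω n) (ω n)
    rw [← ih]
    rfl

theorem contEpochReward_eq (π : M.ContPolicy) (s : M.State) (ω : ℕ → I × I) (n : ℕ) :
    M.contEpochReward π s ω n = (contChain h0 hb hB π s).stageReward n ω := by
  unfold DiscountedChain.stageReward
  rw [← contHist_eq]
  simp only [contEpochReward, integral_exp_penalty, mul_add, Real.exp_add]
  change _ = Real.exp (-M.gamma * (M.contHist π s ω n (Fin.last n)).1) *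
    (Real.exp (-M.gamma * M.holdTime π n (M.contHist π s ω n) (ω n).1) * _ - M.penalty _ *
      ((1 - Real.exp (-M.gamma * M.holdTime π n (M.contHist π s ω n) (ω n).1)) / M.gamma))
  rw [mul_sub, mul_assoc]
  rfl

end Bounds

theorem exists_reward_bound (M : MMModel) : ∃ B, ∀ x : M.State × Quotes M.NP × MMEvent,
    |M.eventReward x.1 x.2.1 x.2.2| + |M.penalty x.1 / M.gamma| ≤ B := by
  obtain ⟨B, hB⟩ := exists_abs_le_of_finite fun x : M.State × Quotes M.NP × MMEvent =>
    |M.eventReward x.1 x.2.1 x.2.2| + |M.penalty x.1 / M.gamma|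
  exact ⟨B, fun x => (le_abs_self _).trans (hB x)⟩

theorem contReward_wellDefined (hrate : M.RateAssumption) (π : M.ContPolicy) (s : M.State) :
    (∀ᵐ ω ∂contMeasure, Summable (M.contEpochReward π s ω)) ∧
      Integrable (M.contReward π s) contMeasure := by
  obtain ⟨l, L, h0, hb⟩ := exists_totalRate_bounds hrate
  obtain ⟨B, hB⟩ := M.exists_reward_bound
  have h1 := (contChain h0 hb hB π s).ae_summable_stageReward
  have h2 := (contChain h0 hb hB π s).integrable_tsum_stageReward
  simp only [← contEpochReward_eq] at h1 h2
  exact ⟨h1, h2⟩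

/-- A supersolution of the Bellman equation dominates the value of a policy. -/
theorem contValue_le (hrate : M.RateAssumption) (π : M.ContPolicy) {W : M.State → ℝ}
    (hW : ∀ n h r, M.eventSum (h (Fin.last n)).2 (π.act n h r)
        (fun e => M.eventReward (h (Fin.last n)).2 (π.act n h r) e
          + W (M.afterEvent (h (Fin.last n)).2 e))
      ≤ (M.gamma + M.totalRate (h (Fin.last n)).2 (π.act n h r)) * W (h (Fin.last n)).2
        + M.penalty (h (Fin.last n)).2) (s : M.State) : M.contValue π s ≤ W s := by
  obtain ⟨l, L, h0, hb⟩ := exists_totalRate_bounds hrate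
  obtain ⟨B, hB⟩ := M.exists_reward_bound
  obtain ⟨b, hWb⟩ := exists_abs_le_of_finite W
  have h := (contChain h0 hb hB π s).integral_tsum_le (w := fun n h => W (h (Fin.last n)).2)
    (fun n => (measurable_of_countable W).comp (measurable_last_state n)) (b := b) (ε := 0)
    (fun n h => hWb _) le_rfl fun n h => by
      have e : ∀ z, ((contChain h0 hb hB π s).next n h z (Fin.last (n + 1))).2 =
          M.epochState (h (Fin.last n)).2 (π.act n h) z := fun z => by
        exact congrArg Prod.snd (Fin.snoc_last (α := fun _ => ℝ × M.State) _ _)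
      have := integral_epoch_le hrate (measurable_act_path π n h) (π.feasible n h) h0
        (fun r => (hb _ _ (π.feasible n h r)).1) (fun r => (hb _ _ (π.feasible n h r)).2)
        (hW n h)
      simp only [e, add_zero]
      exact this
  simp only [← contEpochReward_eq, zero_div, add_zero] at h
  exact h

/-- The value of a policy dominates a subsolution of its evaluation equation. -/
theorem le_contValue (hrate : M.RateAssumption) (π : M.ContPolicy) {W : M.State → ℝ}
    (hW : ∀ n h r,
      (M.gamma + M.totalRate (h (Fin.last n)).2 (π.act n h r)) * W (h (Fin.last n)).2
        + M.penalty (h (Fin.last n)).2 ≤ M.eventSum (h (Fin.last n)).2 (π.act n h r)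
        (fun e => M.eventReward (h (Fin.last n)).2 (π.act n h r) e
          + W (M.afterEvent (h (Fin.last n)).2 e))) (s : M.State) : W s ≤ M.contValue π s := by
  obtain ⟨l, L, h0, hb⟩ := exists_totalRate_bounds hrate
  obtain ⟨B, hB⟩ := M.exists_reward_bound
  obtain ⟨b, hWb⟩ := exists_abs_le_of_finite W
  have h := (contChain h0 hb hB π s).le_integral_tsum (w := fun n h => W (h (Fin.last n)).2)
    (fun n => (measurable_of_countable W).comp (measurable_last_state n)) (b := b) (ε := 0)
    (fun n h => hWb _) le_rfl fun n h => by
      have e : ∀ z, ((contChain h0 hb hB π s).next n h z (Fin.last (n + 1))).2 =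
          M.epochState (h (Fin.last n)).2 (π.act n h) z := fun z => by
        exact congrArg Prod.snd (Fin.snoc_last (α := fun _ => ℝ × M.State) _ _)
      have := le_integral_epoch hrate (measurable_act_path π n h) (π.feasible n h) h0
        (fun r => (hb _ _ (π.feasible n h r)).1) (fun r => (hb _ _ (π.feasible n h r)).2)
        (hW n h)
      simp only [e, sub_zero]
      exact this
  simp only [← contEpochReward_eq, zero_div, sub_zero] at h
  exact h

/-! ### The Bellman equation in continuous time -/

/-- The Bellman equation restricted to nonempty sets of feasible quotes has a solution. -/
theorem exists_cont_bellman (hrate : M.RateAssumption) (A : M.State → Set (Quotes M.NP))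
    (hA : ∀ s, ∀ a ∈ A s, M.Feasible s a) (hne : ∀ s, (A s).Nonempty) :
    ∃ (W : M.State → ℝ) (ϖ : M.State → Quotes M.NP), (∀ s, ϖ s ∈ A s) ∧
      (∀ s, M.eventSum s (ϖ s) (fun e => M.eventReward s (ϖ s) e + W (M.afterEvent s e))
        = (M.gamma + M.totalRate s (ϖ s)) * W s + M.penalty s) ∧
      ∀ s, ∀ a ∈ A s, M.eventSum s a (fun e => M.eventReward s a e + W (M.afterEvent s e))
        ≤ (M.gamma + M.totalRate s a) * W s + M.penalty s := by
  obtain ⟨l, L, h0, hb⟩ := exists_totalRate_bounds hrate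
  have hγ := M.gamma_pos
  have hLpos : 0 < L := by
    obtain ⟨a, ha⟩ := exists_feasible (Classical.arbitrary M.State)
    exact h0.trans_le ((hb _ _ ha).1.trans (hb _ _ ha).2)
  obtain ⟨W, ϖ, hϖ, heq, hle⟩ := exists_bellman_solution
    -- Uniformization: fictitious jumps from s to itself at rate L - R(s,a) bring every total rate
    -- to `L`, which makes the operator a contraction with factor L/(γ + L) for all actions. The
    -- coefficients stay nonnegative because R ≤ L.
    (fun s a W => (M.eventSum s a (fun e => M.eventReward s a e + W (M.afterEvent s e))
      + (L - M.totalRate s a) * W s - M.penalty s) / (M.gamma + L)) A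
    (fun s => Set.toFinite _) hne (q := L / (M.gamma + L)) (by positivity)
    ((div_lt_one (by positivity)).2 (by linarith)) (by
      intro s a ha W W' b hd
      have hf := hA s a ha
      rw [← sub_div, abs_div, abs_of_pos (by positivity : 0 < M.gamma + L), div_mul_eq_mul_div]
      refine div_le_div_of_nonneg_right ?_ (by positivity)
      have hr := eventRate_nonneg hrate s a
      have ht := (hb s a hf).2
      have habs : ∀ (r : ℝ) (s' : M.State), 0 ≤ r → |r * (W s' - W' s')| ≤ r * b :=
        fun r s' h => by
          rw [abs_mul, abs_of_nonneg h]
          exact mul_le_mul_of_nonneg_left (hd s') h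
      have e : M.eventSum s a (fun e => M.eventReward s a e + W (M.afterEvent s e))
          + (L - M.totalRate s a) * W s - M.penalty s
          - (M.eventSum s a (fun e => M.eventReward s a e + W' (M.afterEvent s e))
          + (L - M.totalRate s a) * W' s - M.penalty s)
          = M.eventRate s a .up * (W (M.afterEvent s .up) - W' (M.afterEvent s .up))
          + M.eventRate s a .down * (W (M.afterEvent s .down) - W' (M.afterEvent s .down))
          + M.eventRate s a .sell * (W (M.afterEvent s .sell) - W' (M.afterEvent s .sell))
          + M.eventRate s a .buy * (W (M.afterEvent s .buy) - W' (M.afterEvent s .buy))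
          + (L - M.totalRate s a) * (W s - W' s) := by
        simp only [eventSum]; ring
      rw [e]
      have h1 := habs _ (M.afterEvent s .up) (hr .up)
      have h2 := habs _ (M.afterEvent s .down) (hr .down)
      have h3 := habs _ (M.afterEvent s .sell) (hr .sell)
      have h4 := habs _ (M.afterEvent s .buy) (hr .buy)
      have h5 := habs (L - M.totalRate s a) s (by linarith)
      have h6 : M.totalRate s a = M.eventRate s a .up + M.eventRate s a .down
        + M.eventRate s a .sell + M.eventRate s a .buy := rfl
      rw [abs_le] at *
      rw [h6] at h5 ⊢
      constructor <;> nlinarith)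
  refine ⟨W, ϖ, hϖ, fun s => ?_, fun s a ha => ?_⟩
  · have := heq s
    rw [div_eq_iff (by positivity)] at this
    linarith
  · have := hle s a ha
    rw [div_le_iff₀ (by positivity)] at this
    linarith

/-- The value of a stationary policy solves the evaluation equation. -/
theorem contValue_stat_equation (hrate : M.RateAssumption) (ϖ : M.StatPolicy) (s : M.State) :
    M.eventSum s (ϖ.act s) (fun e => M.eventReward s (ϖ.act s) e
        + M.contValue ϖ.toCont (M.afterEvent s e))
      = (M.gamma + M.totalRate s (ϖ.act s)) * M.contValue ϖ.toCont s + M.penalty s := by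
  -- With a single allowed action in each state the Bellman equation is the evaluation equation, and
  -- verification from both sides identifies its solution with the value.
  obtain ⟨W, τ, hτ, heq, -⟩ := exists_cont_bellman hrate (fun s => {ϖ.act s})
    (fun s a ha => by rw [Set.mem_singleton_iff.1 ha]; exact ϖ.feasible s)
    (fun s => Set.singleton_nonempty _)
  have hτϖ : τ = ϖ.act := funext hτ
  rw [hτϖ] at heq
  have hW : ∀ s, M.contValue ϖ.toCont s = W s := fun s =>
    le_antisymm (contValue_le hrate ϖ.toCont (fun n h r => (heq (h (Fin.last n)).2).le) s)
      (le_contValue hrate ϖ.toCont (fun n h r => (heq (h (Fin.last n)).2).ge) s)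
  simp only [hW]
  exact heq s

theorem exists_cont_optimal (hrate : M.RateAssumption) :
    (∀ s : M.State, BddAbove (Set.range fun π : M.ContPolicy => M.contValue π s)) ∧
      ∃ ϖ : M.StatPolicy, M.IsContOptimal ϖ := by
  obtain ⟨W, ϖ, hϖ, heq, hle⟩ := exists_cont_bellman hrate (fun s => {a | M.Feasible s a})
    (fun _ _ h => h) exists_feasible
  have hub : ∀ (π : M.ContPolicy) s, M.contValue π s ≤ W s := fun π s =>
    contValue_le hrate π (fun n h r => hle _ _ (π.feasible n h r)) s
  have hbdd : ∀ s : M.State, BddAbove (Set.range fun π : M.ContPolicy => M.contValue π s) :=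
    fun s => ⟨W s, by rintro _ ⟨π, rfl⟩; exact hub π s⟩
  let ϖ' : M.StatPolicy := ⟨ϖ, hϖ⟩
  refine ⟨hbdd, ϖ', fun s => le_antisymm ?_ (le_ciSup (hbdd s) ϖ'.toCont)⟩
  have : Nonempty M.ContPolicy := ⟨ϖ'.toCont⟩
  exact (ciSup_le fun π => hub π s).trans
    (le_contValue hrate ϖ'.toCont (fun n h r => (heq (h (Fin.last n)).2).ge) s)

end MMModel


namespace MMModel

variable {M : MMModel}

/-! ### One stage of the discrete-time problem -/

/-- The distribution of the three uniform variables that drive one stage. -/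
abbrev stageMeasure : Measure (I × I × I) :=
  (volume : Measure I).prod ((volume : Measure I).prod (volume : Measure I))

theorem measurable_discNextPrice (Δ : ℝ) (k : M.PriceIdx) (a : Quotes M.NP) :
    Measurable fun u : I => M.discNextPrice Δ k a u := by
  have hm : ∀ x, MeasurableSet {v : I | (v : ℝ) < x} := fun x =>
    measurableSet_lt measurable_subtype_coe measurable_const
  unfold discNextPrice
  exact Measurable.ite (hm _) measurable_const
    (Measurable.ite (hm _) measurable_const measurable_const)

theorem measurable_discFill (Δ : ℝ) (k : M.PriceIdx) (q : Option (Fin (M.NP + 1))) :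
    Measurable fun u : I => M.discFill Δ k q u := by
  unfold discFill
  exact Measurable.ite (measurableSet_lt measurable_subtype_coe measurable_const)
    measurable_const measurable_const

theorem measurable_stage (Δ : ℝ) (k : M.PriceIdx) (a : Quotes M.NP) :
    Measurable fun z : I × I × I => (M.discNextPrice Δ k a z.1,
      M.discFill Δ k a.ask z.2.1, M.discFill Δ k a.bid z.2.2) :=
  ((measurable_discNextPrice Δ k a).comp measurable_fst).prodMk
    (((measurable_discFill Δ k a.ask).comp (measurable_fst.comp measurable_snd)).prodMk
      ((measurable_discFill Δ k a.bid).comp (measurable_snd.comp measurable_snd)))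

/-- Fill indicators are 0 or 1, so only finitely many values of `g` occur. -/
theorem exists_stage_bound (g : M.PriceIdx → ℤ → ℤ → ℝ) :
    ∃ B, ∀ (Δ : ℝ) (k k' : M.PriceIdx) (q q' : Option (Fin (M.NP + 1))) (x v w : ℝ)
      (a : Quotes M.NP), |g (M.discNextPrice Δ k a x) (M.discFill Δ k q v) (M.discFill Δ k' q' w)|
        ≤ B := by
  obtain ⟨B, hB⟩ := exists_abs_le_of_finite fun p : M.PriceIdx × Bool × Bool =>
    g p.1 (if p.2.1 then 1 else 0) (if p.2.2 then 1 else 0)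
  refine ⟨B, fun Δ k k' q q' x v w a => ?_⟩
  simpa [discFill] using hB (M.discNextPrice Δ k a x, decide (v < M.fillRate k q * Δ),
    decide (w < M.fillRate k' q' * Δ))

theorem integral_discFill {Δ : ℝ} (hΔ : 0 < Δ) {k : M.PriceIdx}
    {q : Option (Fin (M.NP + 1))} (h : M.fillRate k q * Δ ≤ 1) (f : ℤ → ℝ) :
    ∫ u : I, f (M.discFill Δ k q u) = f 0 + M.fillRate k q * Δ * (f 1 - f 0) := by
  have h0 := fillRate_nonneg k q
  have e : (fun u : I => f (M.discFill Δ k q u)) = fun u : I =>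
      f 0 + (f 1 - f 0) * (if (u : ℝ) < M.fillRate k q * Δ then (1 : ℝ) else 0) := by
    ext u
    unfold discFill
    split_ifs <;> simp
  rw [e, integral_add (integrable_const _) ((integrable_ite_unitInterval_lt _ _ _).const_mul _),
    integral_const_mul, integral_unitInterval_ite_lt (by positivity) h]
  simp
  ring

theorem integral_discNextPrice (hrate : M.RateAssumption) {Δ : ℝ} (hΔ : 0 < Δ)
    {k : M.PriceIdx} {a : Quotes M.NP} (h : (M.upRate k a + M.downRate k a) * Δ ≤ 1)
    (f : M.PriceIdx → ℝ) :
    ∫ u : I, f (M.discNextPrice Δ k a u) = f k + Δ * (M.upRate k a * (f (M.moveUp k) - f k)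
      + M.downRate k a * (f (M.moveDown k) - f k)) := by
  have h1 := upRate_nonneg hrate k a
  have h2 := downRate_nonneg hrate k a
  have h3 : M.upRate k a * Δ ≤ (M.upRate k a + M.downRate k a) * Δ := by nlinarith
  have e : (fun u : I => f (M.discNextPrice Δ k a u)) = fun u : I =>
      f k + ((f (M.moveDown k) - f k) *
          (if (u : ℝ) < (M.upRate k a + M.downRate k a) * Δ then (1 : ℝ) else 0)
        + (f (M.moveUp k) - f (M.moveDown k)) *
          (if (u : ℝ) < M.upRate k a * Δ then (1 : ℝ) else 0)) := by
    ext u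
    unfold discNextPrice
    split_ifs <;> first | (exfalso; linarith) | ring
  have hi : ∀ c p, Integrable fun u : I => c * (if (u : ℝ) < p then (1 : ℝ) else 0) :=
    fun c p => (integrable_ite_unitInterval_lt _ _ _).const_mul _
  have hi2 : ∀ c p c' p', Integrable fun u : I => c * (if (u : ℝ) < p then (1 : ℝ) else 0)
      + c' * (if (u : ℝ) < p' then (1 : ℝ) else 0) := fun c p c' p' => (hi c p).add (hi c' p')
  rw [e, integral_add (integrable_const _) (hi2 _ _ _ _), integral_add (hi _ _) (hi _ _), integral_const_mul, integral_const_mul,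
    integral_unitInterval_ite_lt (by positivity) h,
    integral_unitInterval_ite_lt (by positivity) (h3.trans h)]
  simp
  ring

theorem integrable_stage (Δ : ℝ) (k : M.PriceIdx) (a : Quotes M.NP)
    (g : M.PriceIdx → ℤ → ℤ → ℝ) : Integrable (fun z : I × I × I =>
      g (M.discNextPrice Δ k a z.1) (M.discFill Δ k a.ask z.2.1) (M.discFill Δ k a.bid z.2.2))
      stageMeasure := by
  obtain ⟨B, hB⟩ := exists_stage_bound g
  exact Integrable.of_bound (C := B) ((measurable_of_countable fun p : M.PriceIdx × ℤ × ℤ =>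
    g p.1 p.2.1 p.2.2).comp (measurable_stage Δ k a)).aestronglyMeasurable
    (Filter.Eventually.of_forall fun z => hB _ _ _ _ _ _ _ _ _)

/-- Fubini over the three independent draws. The statement keeps the nested form, each one-variable
average being applied to the next inner one. -/
theorem integral_stage (hrate : M.RateAssumption) {Δ : ℝ} (hΔ : 0 < Δ) (hv : M.ValidStep Δ)
    {s : M.State} {a : Quotes M.NP} (h : M.Feasible s a) (g : M.PriceIdx → ℤ → ℤ → ℝ) :
    ∫ z, g (M.discNextPrice Δ s.1 a z.1) (M.discFill Δ s.1 a.ask z.2.1)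
        (M.discFill Δ s.1 a.bid z.2.2) ∂stageMeasure =
      (fun f : M.PriceIdx → ℝ => f s.1 + Δ * (M.upRate s.1 a * (f (M.moveUp s.1) - f s.1)
        + M.downRate s.1 a * (f (M.moveDown s.1) - f s.1))) fun x =>
      (fun f : ℤ → ℝ => f 0 + M.fillRate s.1 a.ask * Δ * (f 1 - f 0)) fun i =>
        g x i 0 + M.fillRate s.1 a.bid * Δ * (g x i 1 - g x i 0) := by
  obtain ⟨h1, h2, h3⟩ := hv s a h
  refine Eq.trans ?_ (integral_discNextPrice hrate hΔ h1 fun x =>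
    (fun f : ℤ → ℝ => f 0 + M.fillRate s.1 a.ask * Δ * (f 1 - f 0)) fun i =>
        g x i 0 + M.fillRate s.1 a.bid * Δ * (g x i 1 - g x i 0))
  rw [integral_prod _ (integrable_stage Δ s.1 a g)]
  refine integral_congr_ae (Filter.Eventually.of_forall fun u => ?_)
  have hi : Integrable (fun z : I × I => g (M.discNextPrice Δ s.1 a u)
      (M.discFill Δ s.1 a.ask z.1) (M.discFill Δ s.1 a.bid z.2))
      ((volume : Measure I).prod (volume : Measure I)) := by
    obtain ⟨B, hB⟩ := exists_stage_bound g
    exact Integrable.of_bound (C := B) ((measurable_of_countable fun p : M.PriceIdx × ℤ × ℤ =>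
      g p.1 p.2.1 p.2.2).comp ((measurable_stage Δ s.1 a).comp
        (measurable_const (a := u) |>.prodMk measurable_id))).aestronglyMeasurable
      (Filter.Eventually.of_forall fun z => hB _ _ _ _ _ _ _ _ _)
  simp only
  rw [← integral_discFill hΔ h2 (fun i => g (M.discNextPrice Δ s.1 a u) i 0
    + M.fillRate s.1 a.bid * Δ * (g (M.discNextPrice Δ s.1 a u) i 1
      - g (M.discNextPrice Δ s.1 a u) i 0)), integral_prod _ hi]
  refine integral_congr_ae (Filter.Eventually.of_forall fun v => ?_)
  exact integral_discFill hΔ h3 fun j =>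
    g (M.discNextPrice Δ s.1 a u) (M.discFill Δ s.1 a.ask v) j

/-- The stage reward plus a discounted terminal payoff, as a function of the next mid-price and of
the fill indicators. -/
def stagePayoff (M : MMModel) (Δ : ℝ) (s : M.State) (a : Quotes M.NP) (W : M.State → ℝ)
    (x : M.PriceIdx) (i j : ℤ) : ℝ :=
  M.sellProfit s a.ask * (i : ℝ) + M.buyProfit s a.bid * (j : ℝ)
    + (M.mid x - M.mid s.1) * M.inv s - M.penalty s * Δ
    + Real.exp (-(M.gamma * Δ)) * W (x, M.addInv s.2 (-i + j))

theorem addInv_zero (y : M.Inventory) : M.addInv y 0 = y := by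
  simp [addInv, Set.projIcc_of_mem _ y.2]

/-- The reward is additive over the price move and the two fills, so its mean is exactly linear in
Δ; higher powers come only from `W` when several events fall in one stage. What matters is that `r₂`
and `r₃` do not depend on Δ. -/
theorem integral_stagePayoff_expansion (hrate : M.RateAssumption) (W : M.State → ℝ) :
    ∃ r₂ r₃ : M.State → Quotes M.NP → ℝ, ∀ Δ : ℝ, 0 < Δ → M.ValidStep Δ →
      ∀ s a, M.Feasible s a →
      ∫ z, (M.discStepReward Δ s a z + Real.exp (-(M.gamma * Δ)) * W (M.discNext Δ s a z))
        ∂stageMeasure =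
      Δ * (M.eventSum s a (M.eventReward s a) - M.penalty s) + Real.exp (-(M.gamma * Δ)) *
        (W s + Δ * (M.eventSum s a (fun e => W (M.afterEvent s e)) - M.totalRate s a * W s)
          + Δ ^ 2 * r₂ s a + Δ ^ 3 * r₃ s a) := by
  let D : M.State → Quotes M.NP → ℤ → ℝ := fun s a m =>
    M.upRate s.1 a * (W (M.moveUp s.1, M.addInv s.2 m) - W (s.1, M.addInv s.2 m))
      + M.downRate s.1 a * (W (M.moveDown s.1, M.addInv s.2 m) - W (s.1, M.addInv s.2 m))
  -- The quadratic term collects a price move with one fill, and two fills (which leave the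
  -- inventory unchanged); the cubic term is a price move with both fills.
  refine ⟨fun s a => M.fillRate s.1 a.ask * (D s a (-1) - D s a 0)
      + M.fillRate s.1 a.bid * (D s a 1 - D s a 0)
      + M.fillRate s.1 a.ask * M.fillRate s.1 a.bid *
        (2 * W s - W (s.1, M.addInv s.2 (-1)) - W (s.1, M.addInv s.2 1)),
    fun s a => M.fillRate s.1 a.ask * M.fillRate s.1 a.bid *
        (2 * D s a 0 - D s a (-1) - D s a 1), fun Δ hΔ hv s a h => ?_⟩
  have := integral_stage hrate hΔ hv h (M.stagePayoff Δ s a W)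
  refine Eq.trans this ?_
  simp only [stagePayoff, D, eventSum, totalRate, eventRate, eventReward, afterEvent, neg_zero,
    zero_add, add_zero, Int.cast_zero, Int.cast_one, neg_add_cancel, addInv_zero]
  ring

/-! ### The discrete-time problem as a discounted chain -/

theorem measurable_discNext (Δ : ℝ) (s : M.State) (a : Quotes M.NP) :
    Measurable fun z => M.discNext Δ s a z := by
  have h := (measurable_of_countable fun p : M.PriceIdx × ℤ × ℤ =>
    ((p.1, M.addInv s.2 (-p.2.1 + p.2.2)) : M.State)).comp (measurable_stage Δ s.1 a)
  unfold discNext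
  simpa only [Function.comp_def] using h

theorem measurable_discStepReward (Δ : ℝ) (s : M.State) (a : Quotes M.NP) :
    Measurable fun z => M.discStepReward Δ s a z := by
  have h := (measurable_of_countable fun p : M.PriceIdx × ℤ × ℤ =>
    M.sellProfit s a.ask * (p.2.1 : ℝ) + M.buyProfit s a.bid * (p.2.2 : ℝ)
      + (M.mid p.1 - M.mid s.1) * M.inv s - M.penalty s * Δ).comp (measurable_stage Δ s.1 a)
  unfold discStepReward
  simpa only [Function.comp_def] using h

theorem exists_discStepReward_bound (M : MMModel) (Δ : ℝ) :
    ∃ B, ∀ s a z, |M.discStepReward Δ s a z| ≤ B := by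
  have h : ∀ p : M.State × Quotes M.NP, ∃ B, ∀ z, |M.discStepReward Δ p.1 p.2 z| ≤ B := by
    intro p
    obtain ⟨B, hB⟩ := exists_stage_bound fun (x : M.PriceIdx) (i j : ℤ) =>
      M.sellProfit p.1 p.2.ask * (i : ℝ) + M.buyProfit p.1 p.2.bid * (j : ℝ)
      + (M.mid x - M.mid p.1.1) * M.inv p.1 - M.penalty p.1 * Δ
    exact ⟨B, fun z => hB Δ p.1.1 p.1.1 p.2.ask p.2.bid z.1 z.2.1 z.2.2 p.2⟩
  choose B hB using h
  obtain ⟨B', hB'⟩ := exists_abs_le_of_finite B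
  exact ⟨B', fun s a z => (hB (s, a) z).trans ((le_abs_self _).trans (hB' (s, a)))⟩

section Chain

variable {Δ : ℝ} (hΔ : 0 < Δ) {B : ℝ} (hB : ∀ s a z, |M.discStepReward Δ s a z| ≤ B)

/-- The history of the stages under the policy `π`, as a discounted chain. -/
def discChain (π : M.DiscPolicy) (s : M.State) : DiscountedChain stageMeasure where
  H n := Fin (n + 1) → M.State
  next n h z := Fin.snoc (α := fun _ => M.State) h (M.discNext Δ (h (Fin.last n)) (π.act n h) z)
  init := fun _ => s
  acc n _ := Real.exp (-(n * M.gamma * Δ))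
  disc _ _ _ := Real.exp (-(M.gamma * Δ))
  rew n h z := M.discStepReward Δ (h (Fin.last n)) (π.act n h) z
  q := Real.exp (-(M.gamma * Δ))
  K := B
  measurable_next n := by
    refine (measurable_fin_snoc (n + 1)).comp (measurable_fst.prodMk ?_)
    exact measurable_from_prod_countable_right fun h =>
      measurable_discNext Δ (h (Fin.last n)) (π.act n h)
  measurable_acc n := measurable_const
  measurable_disc n := measurable_const
  measurable_rew n := measurable_from_prod_countable_right fun h =>
    measurable_discStepReward Δ (h (Fin.last n)) (π.act n h)
  acc_init := by simp
  acc_next n h z := by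
    rw [← Real.exp_add]
    congr 1
    push_cast
    ring
  disc_nonneg n h z := (Real.exp_pos _).le
  disc_le_one n h z := Real.exp_le_one_iff.2 (neg_nonpos.2 (mul_pos M.gamma_pos hΔ).le)
  integral_disc_le n h := by simp
  q_lt_one := Real.exp_lt_one_iff.2 (neg_neg_of_pos (mul_pos M.gamma_pos hΔ))
  abs_rew_le n h z := hB _ _ _

theorem discHist_eq (π : M.DiscPolicy) (s : M.State) (ω : ℕ → I × I × I) (n : ℕ) :
    M.discHist Δ π s ω n = (discChain hΔ hB π s).hist ω n := by
  induction n with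
  | zero => rfl
  | succ n ih =>
    change _ = (discChain hΔ hB π s).next n ((discChain hΔ hB π s).hist ω n) (ω n)
    rw [← ih]
    rfl

theorem discStageReward_eq (π : M.DiscPolicy) (s : M.State) (ω : ℕ → I × I × I) (n : ℕ) :
    M.discStageReward Δ π s ω n = (discChain hΔ hB π s).stageReward n ω := by
  unfold DiscountedChain.stageReward
  rw [← discHist_eq]
  rfl

end Chain

theorem discReward_wellDefined {Δ : ℝ} (hΔ : 0 < Δ) (π : M.DiscPolicy) (s : M.State) :
    (∀ᵐ ω ∂discMeasure, Summable (M.discStageReward Δ π s ω)) ∧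
      Integrable (M.discReward Δ π s) discMeasure := by
  obtain ⟨B, hB⟩ := M.exists_discStepReward_bound Δ
  have h1 := (discChain hΔ hB π s).ae_summable_stageReward
  have h2 := (discChain hΔ hB π s).integrable_tsum_stageReward
  simp only [← discStageReward_eq] at h1 h2
  exact ⟨h1, h2⟩

/-- The slack ε is 0 for the existence of optimal policies and of order Δ² in the comparison with
continuous time. -/
theorem discValue_le {Δ : ℝ} (hΔ : 0 < Δ) (π : M.DiscPolicy) {W : M.State → ℝ} {ε : ℝ}
    (hε : 0 ≤ ε) (hW : ∀ n h, ∫ z, (M.discStepReward Δ (h (Fin.last n)) (π.act n h) z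
      + Real.exp (-(M.gamma * Δ)) * W (M.discNext Δ (h (Fin.last n)) (π.act n h) z))
        ∂stageMeasure ≤ W (h (Fin.last n)) + ε) (s : M.State) :
    M.discValue Δ π s ≤ W s + ε / (1 - Real.exp (-(M.gamma * Δ))) := by
  obtain ⟨B, hB⟩ := M.exists_discStepReward_bound Δ
  obtain ⟨b, hWb⟩ := exists_abs_le_of_finite W
  have h := (discChain hΔ hB π s).integral_tsum_le (w := fun n h => W (h (Fin.last n)))
    (fun n => (measurable_of_countable W).comp (measurable_pi_apply (Fin.last n))) (b := b)
    (fun n h => hWb _) hε fun n h => by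
      have e : ∀ z, (discChain hΔ hB π s).next n h z (Fin.last (n + 1)) =
          M.discNext Δ (h (Fin.last n)) (π.act n h) z := fun z =>
        Fin.snoc_last (α := fun _ => M.State) _ _
      simp only [e]
      exact hW n h
  simp only [← discStageReward_eq] at h
  exact h

theorem le_discValue {Δ : ℝ} (hΔ : 0 < Δ) (π : M.DiscPolicy) {W : M.State → ℝ} {ε : ℝ}
    (hε : 0 ≤ ε) (hW : ∀ n h, W (h (Fin.last n)) - ε ≤
      ∫ z, (M.discStepReward Δ (h (Fin.last n)) (π.act n h) z
      + Real.exp (-(M.gamma * Δ)) * W (M.discNext Δ (h (Fin.last n)) (π.act n h) z))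
        ∂stageMeasure) (s : M.State) :
    W s - ε / (1 - Real.exp (-(M.gamma * Δ))) ≤ M.discValue Δ π s := by
  obtain ⟨B, hB⟩ := M.exists_discStepReward_bound Δ
  obtain ⟨b, hWb⟩ := exists_abs_le_of_finite W
  have h := (discChain hΔ hB π s).le_integral_tsum (w := fun n h => W (h (Fin.last n)))
    (fun n => (measurable_of_countable W).comp (measurable_pi_apply (Fin.last n))) (b := b)
    (fun n h => hWb _) hε fun n h => by
      have e : ∀ z, (discChain hΔ hB π s).next n h z (Fin.last (n + 1)) =
          M.discNext Δ (h (Fin.last n)) (π.act n h) z := fun z =>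
        Fin.snoc_last (α := fun _ => M.State) _ _
      simp only [e]
      exact hW n h
  simp only [← discStageReward_eq] at h
  exact h

theorem exists_disc_optimal {Δ : ℝ} (hΔ : 0 < Δ) :
    (∀ s : M.State, BddAbove (Set.range fun π : M.DiscPolicy => M.discValue Δ π s)) ∧
      ∃ ϖ : M.StatPolicy, M.IsDiscOptimal Δ ϖ := by
  have hq1 : Real.exp (-(M.gamma * Δ)) < 1 :=
    Real.exp_lt_one_iff.2 (neg_neg_of_pos (mul_pos M.gamma_pos hΔ))
  obtain ⟨B, hB⟩ := M.exists_discStepReward_bound Δ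
  have hint : ∀ (s : M.State) (a : Quotes M.NP) (W : M.State → ℝ), Integrable (fun z =>
      M.discStepReward Δ s a z + Real.exp (-(M.gamma * Δ)) * W (M.discNext Δ s a z))
      stageMeasure := fun s a W => integrable_stage Δ s.1 a (M.stagePayoff Δ s a W)
  obtain ⟨W, ϖ, hϖ, heq, hle⟩ := exists_bellman_solution
    (fun s a W => ∫ z, (M.discStepReward Δ s a z
      + Real.exp (-(M.gamma * Δ)) * W (M.discNext Δ s a z)) ∂stageMeasure)
    (fun s : M.State => {a | M.Feasible s a}) (fun s => Set.toFinite _) exists_feasible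
    (Real.exp_pos (-(M.gamma * Δ))).le hq1 (by
      intro s a _ W W' b hd
      rw [← integral_sub (hint s a W) (hint s a W')]
      have := norm_integral_le_of_norm_le_const (μ := stageMeasure)
        (f := fun z => M.discStepReward Δ s a z
          + Real.exp (-(M.gamma * Δ)) * W (M.discNext Δ s a z)
          - (M.discStepReward Δ s a z + Real.exp (-(M.gamma * Δ)) * W' (M.discNext Δ s a z)))
        (C := Real.exp (-(M.gamma * Δ)) * b) (Filter.Eventually.of_forall fun z => by
          rw [add_sub_add_left_eq_sub, ← mul_sub, norm_mul,
            Real.norm_of_nonneg (Real.exp_pos _).le]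
          exact mul_le_mul_of_nonneg_left (hd _) (Real.exp_pos _).le)
      simpa using this)
  have hub : ∀ (π : M.DiscPolicy) s, M.discValue Δ π s ≤ W s := fun π s => by
    have := discValue_le hΔ π (ε := 0) le_rfl
      (fun n h => (hle (h (Fin.last n)) _ (π.feasible n h)).trans_eq (add_zero _).symm) s
    simpa using this
  have hbdd : ∀ s : M.State, BddAbove (Set.range fun π : M.DiscPolicy => M.discValue Δ π s) :=
    fun s => ⟨W s, by rintro _ ⟨π, rfl⟩; exact hub π s⟩
  let ϖ' : M.StatPolicy := ⟨ϖ, hϖ⟩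
  refine ⟨hbdd, ϖ', fun s => le_antisymm ?_ (le_ciSup (hbdd s) ϖ'.toDisc)⟩
  have : Nonempty M.DiscPolicy := ⟨ϖ'.toDisc⟩
  refine (ciSup_le fun π => hub π s).trans ?_
  have := le_discValue hΔ ϖ'.toDisc (ε := 0) le_rfl
    (fun n h => (sub_zero _).trans_le (heq (h (Fin.last n))).ge) s
  simpa using this

end MMModel


namespace MMModel

variable {M : MMModel}

/-! ### Convergence as the time step tends to zero -/

theorem eventSum_add (s : M.State) (a : Quotes M.NP) (g g' : MMEvent → ℝ) :
    M.eventSum s a (fun e => g e + g' e) = M.eventSum s a g + M.eventSum s a g' := by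
  simp only [eventSum]
  ring

theorem exists_validStep (M : MMModel) : ∃ Δ₀ : ℝ, 0 < Δ₀ ∧ ∀ Δ : ℝ, 0 < Δ → Δ < Δ₀ →
    M.ValidStep Δ := by
  obtain ⟨B, hB⟩ := exists_abs_le_of_finite fun p : M.State × Quotes M.NP =>
    |M.upRate p.1.1 p.2 + M.downRate p.1.1 p.2| + |M.fillRate p.1.1 p.2.ask|
      + |M.fillRate p.1.1 p.2.bid|
  have hB0 : 0 ≤ B := (abs_nonneg _).trans (hB (Classical.arbitrary _))
  refine ⟨1 / (B + 1), by positivity, fun Δ h0 h1 s a _ => ?_⟩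
  have hlt : Δ * (B + 1) < 1 := (lt_div_iff₀ (by positivity)).1 h1
  have h := (le_abs_self _).trans (hB (s, a))
  simp only at h
  have key : ∀ x, |x| ≤ B → x * Δ ≤ 1 := fun x hx => by
    have := (le_abs_self x).trans hx
    nlinarith
  have p1 := abs_nonneg (M.upRate s.1 a + M.downRate s.1 a)
  have p2 := abs_nonneg (M.fillRate s.1 a.ask)
  have p3 := abs_nonneg (M.fillRate s.1 a.bid)
  exact ⟨key _ (by linarith), key _ (by linarith), key _ (by linarith)⟩

theorem abs_exp_neg_sub_one_add_le {x : ℝ} (hx : 0 ≤ x) : |Real.exp (-x) - 1 + x| ≤ x ^ 2 := by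
  have h1 := Real.add_one_le_exp (-x)
  have h2 : Real.exp (-x) * (1 + x) ≤ 1 := by
    have := Real.add_one_le_exp x
    calc Real.exp (-x) * (1 + x) ≤ Real.exp (-x) * Real.exp x :=
          mul_le_mul_of_nonneg_left (by linarith) (Real.exp_pos _).le
      _ = 1 := by rw [← Real.exp_add]; simp
  rw [abs_of_nonneg (by linarith)]
  nlinarith

/-- The values of a stationary policy in the two problems differ by `O(Δ)`. -/
theorem exists_discValue_sub_contValue_le (hrate : M.RateAssumption) (ϖ : M.StatPolicy) :
    ∃ C : ℝ, ∀ Δ : ℝ, 0 < Δ → Δ ≤ 1 → M.ValidStep Δ → ∀ s,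
      |M.discValue Δ ϖ.toDisc s - M.contValue ϖ.toCont s| ≤ C * Δ := by
  set V : M.State → ℝ := M.contValue ϖ.toCont with hV
  have hγ := M.gamma_pos
  obtain ⟨r₂, r₃, hexp⟩ := integral_stagePayoff_expansion hrate V
  -- `G` is the generator of the controlled process applied to V, and the evaluation equation reads:
  -- reward rate = γV - G. The first-order terms of the discrete expansion then cancel.
  let G : M.State → ℝ := fun s => M.eventSum s (ϖ.act s) (fun e => V (M.afterEvent s e))
    - M.totalRate s (ϖ.act s) * V s
  have heq : ∀ s, M.eventSum s (ϖ.act s) (M.eventReward s (ϖ.act s)) - M.penalty s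
      = M.gamma * V s - G s := fun s => by
    have := contValue_stat_equation hrate ϖ s
    rw [eventSum_add] at this
    simp only [G]
    linarith
  obtain ⟨K, hK⟩ := exists_abs_le_of_finite fun s => M.gamma ^ 2 * |V s| + M.gamma * |G s|
    + |r₂ s (ϖ.act s)| + |r₃ s (ϖ.act s)|
  have hK0 : 0 ≤ K := (abs_nonneg _).trans (hK (Classical.arbitrary _))
  refine ⟨K * (1 + M.gamma) / M.gamma, fun Δ hΔ hΔ1 hv s => ?_⟩
  have hx : 0 < M.gamma * Δ := mul_pos hγ hΔ
  have hEpos := Real.exp_pos (-(M.gamma * Δ))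
  have hE1 := Real.exp_le_one_iff.2 (neg_nonpos.2 hx.le)
  have hElow := Real.add_one_le_exp (-(M.gamma * Δ))
  have hEsq := abs_exp_neg_sub_one_add_le hx.le
  have hone : ∀ s, |(∫ z, (M.discStepReward Δ s (ϖ.act s) z
      + Real.exp (-(M.gamma * Δ)) * V (M.discNext Δ s (ϖ.act s) z)) ∂stageMeasure) - V s|
      ≤ K * Δ ^ 2 := by
    intro s
    rw [hexp Δ hΔ hv s _ (ϖ.feasible s), heq s]
    change |Δ * (M.gamma * V s - G s) + Real.exp (-(M.gamma * Δ)) * (V s + Δ * G s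
      + Δ ^ 2 * r₂ s (ϖ.act s) + Δ ^ 3 * r₃ s (ϖ.act s)) - V s| ≤ K * Δ ^ 2
    have hKs := (le_abs_self _).trans (hK s)
    generalize Real.exp (-(M.gamma * Δ)) = E at *
    generalize r₂ s (ϖ.act s) = a at *
    generalize r₃ s (ϖ.act s) = b at *
    generalize G s = g at *
    generalize V s = v at *
    have e : Δ * (M.gamma * v - g) + E * (v + Δ * g + Δ ^ 2 * a + Δ ^ 3 * b) - v
        = (E - 1 + M.gamma * Δ) * v + (E - 1) * (Δ * g) + E * (Δ ^ 2 * a) + E * (Δ ^ 3 * b) := by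
      ring
    have h1 : |(E - 1 + M.gamma * Δ) * v| ≤ Δ ^ 2 * (M.gamma ^ 2 * |v|) := by
      rw [abs_mul]
      calc _ ≤ (M.gamma * Δ) ^ 2 * |v| := mul_le_mul_of_nonneg_right hEsq (abs_nonneg _)
        _ = _ := by ring
    have h2 : |(E - 1) * (Δ * g)| ≤ Δ ^ 2 * (M.gamma * |g|) := by
      rw [abs_mul, abs_mul, abs_of_pos hΔ, abs_of_nonpos (by linarith : E - 1 ≤ 0)]
      calc _ ≤ (M.gamma * Δ) * (Δ * |g|) :=
            mul_le_mul_of_nonneg_right (by linarith) (by positivity)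
        _ = _ := by ring
    have h3 : |E * (Δ ^ 2 * a)| ≤ Δ ^ 2 * |a| := by
      rw [abs_mul, abs_mul, abs_of_pos hEpos, abs_of_pos (by positivity : 0 < Δ ^ 2)]
      exact mul_le_of_le_one_left (by positivity) hE1
    have h4 : |E * (Δ ^ 3 * b)| ≤ Δ ^ 2 * |b| := by
      rw [abs_mul, abs_mul, abs_of_pos hEpos, abs_of_pos (by positivity : 0 < Δ ^ 3)]
      refine (mul_le_of_le_one_left (by positivity) hE1).trans ?_
      -- Here Δ ≤ 1 absorbs the cubic term into the quadratic one.
      exact mul_le_mul_of_nonneg_right (pow_le_pow_of_le_one hΔ.le hΔ1 (by norm_num))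
        (abs_nonneg _)
    rw [e]
    refine (abs_add_le _ _).trans ?_
    have h5 := abs_add_le ((E - 1 + M.gamma * Δ) * v + (E - 1) * (Δ * g)) (E * (Δ ^ 2 * a))
    have h6 := abs_add_le ((E - 1 + M.gamma * Δ) * v) ((E - 1) * (Δ * g))
    have h7 := mul_le_mul_of_nonneg_left hKs (sq_nonneg Δ)
    linarith
  have hε : 0 ≤ K * Δ ^ 2 := by positivity
  have hup := discValue_le hΔ ϖ.toDisc (W := V) hε (fun n h => by
    have := (abs_le.1 (hone (h (Fin.last n)))).2
    exact sub_le_iff_le_add'.1 this) s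
  have hlo := le_discValue hΔ ϖ.toDisc (W := V) hε (fun n h => by
    have h1 := (abs_le.1 (hone (h (Fin.last n)))).1
    exact (le_of_eq (sub_eq_neg_add _ _)).trans (le_sub_iff_add_le.1 h1)) s
  have hfrac : K * Δ ^ 2 / (1 - Real.exp (-(M.gamma * Δ)))
      ≤ K * (1 + M.gamma) / M.gamma * Δ := by
    have h1 : Real.exp (-(M.gamma * Δ)) * (1 + M.gamma * Δ) ≤ 1 := by
      have := Real.add_one_le_exp (M.gamma * Δ)
      calc _ ≤ Real.exp (-(M.gamma * Δ)) * Real.exp (M.gamma * Δ) :=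
            mul_le_mul_of_nonneg_left (by linarith) hEpos.le
        _ = 1 := by rw [← Real.exp_add]; simp
    -- From e^{-x} ≤ 1/(1 + x) one gets 1 - e^{-x} ≥ x/(1 + x) ≥ x/(1 + γ) for x = γΔ ≤ γ; this is
    -- the origin of the constant K(1 + γ)/γ.
    have h2 : M.gamma * Δ ≤ (1 - Real.exp (-(M.gamma * Δ))) * (1 + M.gamma) := by
      nlinarith
    have h3 : 0 < 1 - Real.exp (-(M.gamma * Δ)) := by
      by_contra hn
      have : (1 - Real.exp (-(M.gamma * Δ))) * (1 + M.gamma) ≤ 0 :=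
        mul_nonpos_of_nonpos_of_nonneg (not_lt.1 hn) (by linarith)
      linarith
    rw [div_le_iff₀ h3, div_mul_eq_mul_div, div_mul_eq_mul_div, le_div_iff₀ hγ]
    have h4 := mul_le_mul_of_nonneg_left h2 (mul_nonneg hK0 hΔ.le)
    linarith
  rw [abs_le]
  constructor <;> linarith

end MMModel

end

/-! ### Transfer of the optimal policy to small time steps -/

theorem theorem1 (M : MMModel) (hrate : M.RateAssumption) :
    -- the value functions and optimal value functions are well defined
    ((∀ (π : M.ContPolicy) (s : M.State),
        (∀ᵐ ω ∂MMModel.contMeasure, Summable (M.contEpochReward π s ω)) ∧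
        Integrable (M.contReward π s) MMModel.contMeasure) ∧
      (∀ s : M.State, BddAbove (Set.range fun π : M.ContPolicy => M.contValue π s))) ∧
    (∀ Δ : ℝ, 0 < Δ → M.ValidStep Δ →
      (∀ (π : M.DiscPolicy) (s : M.State),
        (∀ᵐ ω ∂MMModel.discMeasure, Summable (M.discStageReward Δ π s ω)) ∧
        Integrable (M.discReward Δ π s) MMModel.discMeasure) ∧
      (∀ s : M.State, BddAbove (Set.range fun π : M.DiscPolicy => M.discValue Δ π s))) ∧
    -- optimal stationary Markov policies exist
    (∃ π₀ : M.StatPolicy, M.IsContOptimal π₀) ∧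
    (∀ Δ : ℝ, 0 < Δ → M.ValidStep Δ → ∃ πΔ : M.StatPolicy, M.IsDiscOptimal Δ πΔ) ∧
    -- convergence when the optimal policy is unique
    (∀ π₀ : M.StatPolicy, M.IsContOptimal π₀ →
      (∀ π : M.StatPolicy, M.IsContOptimal π → π = π₀) →
      ∃ Δ₀ : ℝ, 0 < Δ₀ ∧ ∃ CV : ℝ, 0 < CV ∧ ∀ Δ : ℝ, 0 < Δ → Δ < Δ₀ →
        M.ValidStep Δ ∧
        (∀ πΔ : M.StatPolicy, M.IsDiscOptimal Δ πΔ → ∀ s, πΔ.act s = π₀.act s) ∧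
        ∀ s : M.State, |M.discOptValue Δ s - M.contOptValue s| ≤ CV * Δ) := by
  refine ⟨⟨MMModel.contReward_wellDefined hrate, (MMModel.exists_cont_optimal hrate).1⟩,
    fun Δ hΔ _ => ⟨MMModel.discReward_wellDefined hΔ, (MMModel.exists_disc_optimal hΔ).1⟩,
    (MMModel.exists_cont_optimal hrate).2, fun Δ hΔ _ => (MMModel.exists_disc_optimal hΔ).2,
    fun π₀ hπ₀ huniq => ?_⟩
  obtain ⟨Δv, hΔv, hvalid⟩ := M.exists_validStep
  choose C hC using fun π : M.StatPolicy => MMModel.exists_discValue_sub_contValue_le hrate π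
  obtain ⟨K, hK⟩ := exists_abs_le_of_finite C
  have hK0 : 0 ≤ K := (abs_nonneg _).trans (hK π₀)
  have hle : ∀ (π : M.ContPolicy) s, M.contValue π s ≤ M.contOptValue s := fun π s =>
    le_ciSup ((MMModel.exists_cont_optimal hrate).1 s) π
  -- Each competitor of π₀ loses η at some state; the value 1 at π₀ itself is arbitrary, so that a
  -- positive minimum can be taken over all policies.
  have hgap : ∀ π : M.StatPolicy, ∃ η : ℝ, 0 < η ∧
      (π ≠ π₀ → ∃ s, M.contValue π.toCont s + η ≤ M.contValue π₀.toCont s) := by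
    intro π
    by_cases h : π = π₀
    · exact ⟨1, one_pos, fun h' => absurd h h'⟩
    · have hn : ¬ M.IsContOptimal π := fun ho => h (huniq π ho)
      unfold MMModel.IsContOptimal at hn
      push Not at hn
      obtain ⟨s, hs⟩ := hn
      have hlt : M.contValue π.toCont s < M.contValue π₀.toCont s :=
        (lt_of_le_of_ne (hle _ s) hs.symm).trans_eq (hπ₀ s)
      exact ⟨_, sub_pos.2 hlt, fun _ => ⟨s, by linarith⟩⟩
  choose η hη hηs using hgap
  obtain ⟨πm, hπm⟩ := Finite.exists_min η
  -- The factor 2 accounts for two errors (K + 1)Δ, one for π₀ and one for its competitor, whose sum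
  -- must stay below the smallest gap. `K + 1` replaces `K` to be positive.
  refine ⟨min (min 1 Δv) (η πm / (2 * (K + 1))), by have := hη πm; positivity, K + 1,
    by linarith, fun Δ hΔ hlt => ?_⟩
  have h1 : Δ ≤ 1 := (hlt.trans_le ((min_le_left _ _).trans (min_le_left _ _))).le
  have hv := hvalid Δ hΔ (hlt.trans_le ((min_le_left _ _).trans (min_le_right _ _)))
  have h2 : Δ * (2 * (K + 1)) < η πm :=
    (lt_div_iff₀ (by positivity)).1 (hlt.trans_le (min_le_right _ _))
  have hclose : ∀ (π : M.StatPolicy) s,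
      |M.discValue Δ π.toDisc s - M.contValue π.toCont s| ≤ (K + 1) * Δ := fun π s =>
    (hC π Δ hΔ h1 hv s).trans
      (mul_le_mul_of_nonneg_right ((le_abs_self _).trans ((hK π).trans (by linarith))) hΔ.le)
  obtain ⟨hbdd, πΔ, hπΔ⟩ := MMModel.exists_disc_optimal (M := M) hΔ
  have huniqΔ : ∀ π : M.StatPolicy, M.IsDiscOptimal Δ π → π = π₀ := by
    intro π hπ
    by_contra hne
    obtain ⟨s, hs⟩ := hηs π hne
    have h3 := (le_ciSup (hbdd s) π₀.toDisc).trans_eq (hπ s)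
    have h4 := (abs_le.1 (hclose π s)).2
    have h5 := (abs_le.1 (hclose π₀ s)).1
    have h6 := hπm π
    linarith
  refine ⟨hv, fun π hπ s => by rw [huniqΔ π hπ], fun s => ?_⟩
  have h7 := hπΔ s
  rw [huniqΔ πΔ hπΔ] at h7
  rw [h7, hπ₀ s]
  exact hclose π₀ s
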